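/- Let $n\ge 2$, $1<p<n$, $\nu>0$, $\mu\ge 1$, $\sigma\in(1,\infty)$, and let $\Omega\subset\mathbb R^n$ be a bounded open set. Let $g:[0,\infty)\to[0,\infty)$ be $C^1$, convex and non-decreasing, with $g(0)=0$, $g(t)>0$ for $t>0$, $g'(0_+)>0$, and $g(\lambda t)\le\lambda^\mu g(t)$ for all $\lambda>1$, $t>0$. Let $f:\Omega\times\mathbb R^n\to\mathbb R$ be a Carathéodory function and $a:\Omega\to[0,\infty)$ a function with $$\nu\, g^p(|z|)-a(x)\le f(x,z)\qquad\text{for a.e. }x\in\Omega\text{ and all }z\in\mathbb R^n .$$ Let $u_*\in W^{1,1}(\Omega)$, and assume that $a$ and $x\mapsto f(x,Du_*(x))$ belong to $L^\sigma(\Omega)$. Put $$\mathcal C=\{w\in u_*+W^{1,1}_0(\Omega):\ f(x,Dw(x))\in L^1(\Omega)\},$$ and let $u\in\mathcal C$ satisfy $\int_\Omega f(x,Du)\,dx\le\int_\Omega f(x,Dw)\,dx$ for all $w\in\mathcal C$. Then: 1. if $\sigma>\frac np$, then $u-u_*\in L^\infty(\Omega)$; 2. if $\sigma=\frac np$, then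 $e^{\tau|u-u_*|}\in L^1(\Omega)$ for some $\tau>0$ that depends only on $n,p,\mu,\nu$ and $\|f(x,Du_*)+a\|_{L^\sigma(\Omega)}$; 3. if $\sigma<\frac np$, then $g(|u-u_*|)\in L_w^{m}(\Omega)$ with $m=\frac{np\sigma}{n-p\sigma}>p^*=\frac{np}{n-p}$, where $L_w^m(\Omega)$ is the Marcinkiewicz space of all measurable $h$ on $\Omega$ for which there is a constant $\gamma$ with $|\{x\in\Omega:|h(x)|>\lambda\}|\le\gamma\lambda^{-m}$ for all $\lambda>0$. Moreover, $u-u_*\in L^\infty(\Omega)$ if and only if $g(|u-u_*|)\in L^\infty(\Omega)$. -/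

import Mathlib

open MeasureTheory Filter Topology Set
open scoped ENNReal ContDiff

noncomputable section

/-- `φ ∈ C_c^∞(Ω)`: smooth, with compact support contained in `Ω`. -/
def IsTestFunction {n : ℕ} (Ω : Set (EuclideanSpace ℝ (Fin n)))
    (φ : EuclideanSpace ℝ (Fin n) → ℝ) : Prop :=
  ContDiff ℝ ∞ φ ∧ HasCompactSupport φ ∧ tsupport φ ⊆ Ω

/-- `G` is a weak (distributional) gradient of `u` on `Ω`: both are locally integrable on `Ω`, and
`∫_Ω u ∂ᵢφ = - ∫_Ω Gᵢ φ` for all `φ ∈ C_c^∞(Ω)` and all coordinates `i`. -/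
def HasWeakGradient {n : ℕ} (Ω : Set (EuclideanSpace ℝ (Fin n)))
    (u : EuclideanSpace ℝ (Fin n) → ℝ)
    (G : EuclideanSpace ℝ (Fin n) → EuclideanSpace ℝ (Fin n)) : Prop :=
  LocallyIntegrableOn u Ω ∧ LocallyIntegrableOn G Ω ∧
    ∀ φ : EuclideanSpace ℝ (Fin n) → ℝ, IsTestFunction Ω φ → ∀ i : Fin n,
      ∫ x in Ω, u x * fderiv ℝ φ x (EuclideanSpace.single i 1) = -∫ x in Ω, G x i * φ x

/-- A weak gradient on an open set is unique up to equality almost everywhere. -/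
theorem HasWeakGradient.ae_eq {n : ℕ} {Ω : Set (EuclideanSpace ℝ (Fin n))} (hΩ : IsOpen Ω)
    {u : EuclideanSpace ℝ (Fin n) → ℝ}
    {G H : EuclideanSpace ℝ (Fin n) → EuclideanSpace ℝ (Fin n)}
    (hG : HasWeakGradient Ω u G) (hH : HasWeakGradient Ω u H) :
    G =ᵐ[volume.restrict Ω] H := by
  have coord : ∀ (K : EuclideanSpace ℝ (Fin n) → EuclideanSpace ℝ (Fin n)),
      LocallyIntegrableOn K Ω → ∀ i, LocallyIntegrableOn (fun x => K x i) Ω := by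
    intro K hK i x hx
    obtain ⟨s, hs, hi⟩ := hK x hx
    exact ⟨s, hs, (EuclideanSpace.proj (𝕜 := ℝ) i).integrable_comp hi⟩
  have key : ∀ i, ∀ᵐ x ∂(volume : Measure (EuclideanSpace ℝ (Fin n))),
      x ∈ Ω → G x i - H x i = 0 := by
    intro i
    have hGi := coord G hG.2.1 i
    have hHi := coord H hH.2.1 i
    refine hΩ.ae_eq_zero_of_integral_contDiff_smul_eq_zero (hGi.sub hHi) ?_
    intro φ hφ hc hs
    have e : ∀ (K : EuclideanSpace ℝ (Fin n) → ℝ),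
        ∫ x, φ x * K x = ∫ x in Ω, K x * φ x := by
      intro K
      rw [setIntegral_eq_integral_of_forall_compl_eq_zero]
      · simp only [mul_comm]
      · intro x hx
        rw [image_eq_zero_of_notMem_tsupport (fun h => hx (hs h)), mul_zero]
    have int : ∀ (K : EuclideanSpace ℝ (Fin n) → ℝ), LocallyIntegrableOn K Ω →
        IntegrableOn (fun x => K x * φ x) Ω := by
      intro K hK
      have h1 : IntegrableOn (fun x => K x * φ x) (tsupport φ) :=
        (hK.integrableOn_compact_subset hs hc).mul_continuousOn hφ.continuous.continuousOn hc
      have h2 : Integrable (fun x => K x * φ x) := by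
        rw [← integrableOn_iff_integrable_of_support_subset (s := tsupport φ)]
        · exact h1
        · intro x hx
          refine subset_tsupport _ ?_
          intro h
          exact hx (by simp [h])
      exact h2.integrableOn
    have h1 := hG.2.2 φ ⟨hφ, hc, hs⟩ i
    have h2 := hH.2.2 φ ⟨hφ, hc, hs⟩ i
    simp only [smul_eq_mul]
    rw [e]
    simp only [sub_mul]
    rw [integral_sub (int _ hGi) (int _ hHi)]
    linarith
  rw [EventuallyEq, ae_restrict_iff' hΩ.measurableSet]
  filter_upwards [ae_all_iff.2 key] with x hx hxΩ
  ext i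
  exact sub_eq_zero.1 (hx i hxΩ)

open Classical in
/-- The weak gradient `Du` of `u` on `Ω` (zero if there is none). -/
def weakGradient {n : ℕ} (Ω : Set (EuclideanSpace ℝ (Fin n)))
    (u : EuclideanSpace ℝ (Fin n) → ℝ) :
    EuclideanSpace ℝ (Fin n) → EuclideanSpace ℝ (Fin n) :=
  if h : ∃ G, HasWeakGradient Ω u G then h.choose else 0

theorem HasWeakGradient.weakGradient {n : ℕ} {Ω : Set (EuclideanSpace ℝ (Fin n))}
    {u : EuclideanSpace ℝ (Fin n) → ℝ}
    {G : EuclideanSpace ℝ (Fin n) → EuclideanSpace ℝ (Fin n)}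
    (hG : HasWeakGradient Ω u G) : HasWeakGradient Ω u (weakGradient Ω u) := by
  have h : ∃ G, HasWeakGradient Ω u G := ⟨G, hG⟩
  rw [_root_.weakGradient, dif_pos h]
  exact h.choose_spec

/-- `u ∈ W^{1,1}(Ω)`. -/
def MemW11 {n : ℕ} (Ω : Set (EuclideanSpace ℝ (Fin n)))
    (u : EuclideanSpace ℝ (Fin n) → ℝ) : Prop :=
  IntegrableOn u Ω ∧ HasWeakGradient Ω u (weakGradient Ω u) ∧ IntegrableOn (weakGradient Ω u) Ω

/-- `u ∈ W₀^{1,1}(Ω)`: the closure of `C_c^∞(Ω)` in `W^{1,1}(Ω)`. -/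
def MemW011 {n : ℕ} (Ω : Set (EuclideanSpace ℝ (Fin n)))
    (u : EuclideanSpace ℝ (Fin n) → ℝ) : Prop :=
  MemW11 Ω u ∧ ∃ φ : ℕ → EuclideanSpace ℝ (Fin n) → ℝ,
    (∀ k, IsTestFunction Ω (φ k)) ∧
    Tendsto (fun k => eLpNorm (fun x => u x - φ k x) 1 (volume.restrict Ω)) atTop (𝓝 0) ∧
    Tendsto (fun k => eLpNorm (fun x => weakGradient Ω u x - gradient (φ k) x) 1
      (volume.restrict Ω)) atTop (𝓝 0)

/-- The assumptions on `g : [0,∞) → [0,∞)`, with exponent `μ`. Only the values of `g` on `[0,∞)`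
matter; the derivatives at `0` are one-sided. -/
structure IsGrowthFunction (g : ℝ → ℝ) (μ : ℝ) : Prop where
  contDiffOn : ContDiffOn ℝ 1 g (Ici 0)
  convexOn : ConvexOn ℝ (Ici 0) g
  monotoneOn : MonotoneOn g (Ici 0)
  map_zero : g 0 = 0
  pos : ∀ t, 0 < t → 0 < g t
  one_le : 1 ≤ μ
  map_mul_le : ∀ lam, 1 < lam → ∀ t, 0 < t → g (lam * t) ≤ lam ^ μ * g t
  deriv_zero_pos : 0 < derivWithin g (Ici 0) 0

/-- `f : Ω × ℝⁿ → ℝ` is a Carathéodory function. -/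
def IsCaratheodory {n : ℕ} (Ω : Set (EuclideanSpace ℝ (Fin n)))
    (f : EuclideanSpace ℝ (Fin n) → EuclideanSpace ℝ (Fin n) → ℝ) : Prop :=
  (∀ z, AEMeasurable (fun x => f x z) (volume.restrict Ω)) ∧
    ∀ᵐ x ∂(volume.restrict Ω), Continuous (f x)

/-- The class of competing functions: `w ∈ u_* + W₀^{1,1}(Ω)` with `f(x, Dw(x)) ∈ L¹(Ω)`. -/
def competitors {n : ℕ} (Ω : Set (EuclideanSpace ℝ (Fin n)))
    (f : EuclideanSpace ℝ (Fin n) → EuclideanSpace ℝ (Fin n) → ℝ)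
    (ustar : EuclideanSpace ℝ (Fin n) → ℝ) : Set (EuclideanSpace ℝ (Fin n) → ℝ) :=
  {w | MemW011 Ω (fun x => w x - ustar x) ∧ IntegrableOn (fun x => f x (weakGradient Ω w x)) Ω}

/-- The variational integral `∫_Ω f(x, Du(x)) dx`. -/
def energy {n : ℕ} (Ω : Set (EuclideanSpace ℝ (Fin n)))
    (f : EuclideanSpace ℝ (Fin n) → EuclideanSpace ℝ (Fin n) → ℝ)
    (u : EuclideanSpace ℝ (Fin n) → ℝ) : ℝ :=
  ∫ x in Ω, f x (weakGradient Ω u x)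

/-- `u` minimizes the variational integral among all competitors. -/
def IsMinimizer {n : ℕ} (Ω : Set (EuclideanSpace ℝ (Fin n)))
    (f : EuclideanSpace ℝ (Fin n) → EuclideanSpace ℝ (Fin n) → ℝ)
    (ustar u : EuclideanSpace ℝ (Fin n) → ℝ) : Prop :=
  u ∈ competitors Ω f ustar ∧ ∀ w ∈ competitors Ω f ustar, energy Ω f u ≤ energy Ω f w

/-- The Marcinkiewicz (weak Lebesgue) space `L_w^m(Ω)`. -/
def MemMarcinkiewicz {n : ℕ} (Ω : Set (EuclideanSpace ℝ (Fin n))) (m : ℝ)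
    (h : EuclideanSpace ℝ (Fin n) → ℝ) : Prop :=
  AEMeasurable h (volume.restrict Ω) ∧
    ∃ γ : ℝ, ∀ lam : ℝ, 0 < lam →
      volume {x ∈ Ω | lam < |h x|} ≤ ENNReal.ofReal (γ / lam ^ m)

end

/-! Write `v = u - u_*`, let `Φ(k)` be the measure of `{|v| > k}`, and let `N(k)` be the `L^σ` norm
of `f(x,Du_*) + a` on that set. Three ingredients give one inequality for `Φ`. Minimality: replacing
`v` by its truncation at `±k` changes the gradient only on `{|v| > k}`, where it becomes `Du_*`; so
the energy of `u` there is at most that of `u_*`. Growth: `g(t)/t` is non-decreasing by convexity,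
so `t ≤ s + s g(t)^p / g(s)^p` for every `s > 0`. With the lower bound on `f` this controls `|Dv|`
on `{|v| > k}` by the energy of `u_*` there, and Hölder's inequality brings in `N(k)`. Sobolev: the
embedding of `W₀^{1,1}` into `L^{n/(n-1)}`, applied to the difference of two truncations of `v`,
bounds `(h - k) Φ(h)^{1-1/n}` by the integral of `|Dv|` over `{|v| > k}`. Together, with `α = 1 -
1/n`, `(h - k) Φ(h)^α ≤ 2 S s (Φ(k) + N(k) Φ(k)^{1-1/σ} / (ν g(s)^p))` for all `s > 0`.

Everything else is the choice of `s`. Taking `s` proportional to `Φ(k)^{-1/(σp)}` and using `g(s) ≥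
c s` turns the right side into a multiple of `Φ(k)^{1-1/(σp)}`. If `σp > n`, this exponent exceeds
`α` and Stampacchia's iteration makes `Φ` vanish at a finite level. If `σp = n`, the exponents
agree; since `N(k) → 0`, the factor of proportionality may be taken arbitrarily small, so `Φ(k+1) ≤
q Φ(k)` for large `k`, whatever `q > 0`. Hence all exponential moments are finite and `τ = 1` serves
for all data. If `σp < n`, `s` is chosen through the value `g(s)`, and comparing levels `k` and `2k`
bounds `Φ(k) g(k)^m`. -/

/-! ### Test functions and gradients in `W₀^{1,1}`. -/

section SobolevSpace

variable {n : ℕ} {Ω : Set (EuclideanSpace ℝ (Fin n))}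

namespace IsTestFunction

variable {φ ψ : EuclideanSpace ℝ (Fin n) → ℝ}

theorem differentiable (hφ : IsTestFunction Ω φ) : Differentiable ℝ φ :=
  hφ.1.differentiable (by simp)

theorem integrable (hφ : IsTestFunction Ω φ) : Integrable φ :=
  hφ.1.continuous.integrable_of_hasCompactSupport hφ.2.1

theorem continuous_fderiv (hφ : IsTestFunction Ω φ) : Continuous (fderiv ℝ φ) :=
  hφ.1.continuous_fderiv (by simp)

theorem integrable_fderiv (hφ : IsTestFunction Ω φ) : Integrable (fderiv ℝ φ) :=
  hφ.continuous_fderiv.integrable_of_hasCompactSupport (hφ.2.1.fderiv ℝ)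

theorem integrable_gradient (hφ : IsTestFunction Ω φ) : Integrable (gradient φ) :=
  (InnerProductSpace.toDual ℝ
    (EuclideanSpace ℝ (Fin n))).symm.toContinuousLinearEquiv.toContinuousLinearMap.integrable_comp
      hφ.integrable_fderiv

theorem sub (hφ : IsTestFunction Ω φ) (hψ : IsTestFunction Ω ψ) :
    IsTestFunction Ω (fun x => φ x - ψ x) := by
  refine ⟨hφ.1.sub hψ.1, hφ.2.1.sub hψ.2.1, ?_⟩
  exact (tsupport_sub φ ψ).trans (union_subset hφ.2.2 hψ.2.2)

theorem comp_left (hφ : IsTestFunction Ω φ) {η : ℝ → ℝ} (hη : ContDiff ℝ ∞ η) (h0 : η 0 = 0) :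
    IsTestFunction Ω (fun x => η (φ x)) :=
  ⟨hη.comp hφ.1, hφ.2.1.comp_left h0,
    (closure_mono (Function.support_comp_subset h0 φ)).trans hφ.2.2⟩

theorem gradient_sub (hφ : IsTestFunction Ω φ) (hψ : IsTestFunction Ω ψ)
    (x : EuclideanSpace ℝ (Fin n)) :
    gradient (fun x => φ x - ψ x) x = gradient φ x - gradient ψ x := by
  simp only [gradient]
  rw [fderiv_fun_sub (hφ.differentiable x) (hψ.differentiable x), map_sub]

theorem gradient_comp_left (hφ : IsTestFunction Ω φ) {η : ℝ → ℝ} (hη : ContDiff ℝ ∞ η)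
    (x : EuclideanSpace ℝ (Fin n)) :
    gradient (fun x => η (φ x)) x = deriv η (φ x) • gradient φ x := by
  have h := ((hη.differentiable (by simp)) (φ x)).hasDerivAt.comp_hasFDerivAt x
    (hφ.differentiable x).hasFDerivAt
  simp only [gradient]
  have h2 : fderiv ℝ (fun x => η (φ x)) x = deriv η (φ x) • fderiv ℝ φ x := h.fderiv
  rw [h2]
  simp

end IsTestFunction

/-- The coordinates of the gradient are the partial derivatives. -/
theorem gradient_apply_eq_fderiv_single (φ : EuclideanSpace ℝ (Fin n) → ℝ)
    (x : EuclideanSpace ℝ (Fin n)) (i : Fin n) :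
    gradient φ x i = fderiv ℝ φ x (EuclideanSpace.single i 1) := by
  rw [← inner_gradient_left, EuclideanSpace.inner_single_right]
  simp

theorem norm_gradient_eq_norm_fderiv (φ : EuclideanSpace ℝ (Fin n) → ℝ)
    (x : EuclideanSpace ℝ (Fin n)) : ‖gradient φ x‖ = ‖fderiv ℝ φ x‖ := by
  simp [gradient]

theorem tendsto_eLpNorm_one_sub_of_dominated {α F : Type*} {m : MeasurableSpace α} {μ : Measure α}
    [NormedAddCommGroup F] {f : ℕ → α → F} {g : α → F} {b : α → ℝ}
    (hf : ∀ k, AEStronglyMeasurable (f k) μ) (hb : Integrable b μ)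
    (h_bound : ∀ k, ∀ᵐ x ∂μ, ‖f k x‖ ≤ b x)
    (h_lim : ∀ᵐ x ∂μ, Tendsto (fun k => f k x) atTop (𝓝 (g x))) :
    Tendsto (fun k => eLpNorm (g - f k) 1 μ) atTop (𝓝 0) := by
  have h := tendsto_lintegral_norm_of_dominated_convergence hf hb.2 h_bound h_lim
  refine h.congr fun k => ?_
  rw [eLpNorm_sub_comm, eLpNorm_one_eq_lintegral_enorm]
  simp [ofReal_norm]

theorem exists_subseq_ae_tendsto_of_eLpNorm_one {α F : Type*} {m : MeasurableSpace α}
    {μ : Measure α} [NormedAddCommGroup F] {f : ℕ → α → F} {g : α → F}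
    (hf : ∀ k, AEStronglyMeasurable (f k) μ) (hg : AEStronglyMeasurable g μ)
    (h : Tendsto (fun k => eLpNorm (g - f k) 1 μ) atTop (𝓝 0)) :
    ∃ ns : ℕ → ℕ, StrictMono ns ∧ ∀ᵐ x ∂μ, Tendsto (fun k => f (ns k) x) atTop (𝓝 (g x)) := by
  refine (tendstoInMeasure_of_tendsto_eLpNorm_of_ne_top one_ne_zero ENNReal.one_ne_top hf hg
    ?_).exists_seq_tendsto_ae
  simpa only [eLpNorm_sub_comm] using h

/-- `G` is the gradient of `v ∈ W₀^{1,1}(Ω)`: the pair `(v, G)` lies in the closure in `L¹(Ω)` of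
the pairs `(φ, ∇φ)` with `φ` a test function. -/
def HasW011Gradient (Ω : Set (EuclideanSpace ℝ (Fin n))) (v : EuclideanSpace ℝ (Fin n) → ℝ)
    (G : EuclideanSpace ℝ (Fin n) → EuclideanSpace ℝ (Fin n)) : Prop :=
  IntegrableOn v Ω ∧ IntegrableOn G Ω ∧ ∀ δ : ℝ≥0∞, 0 < δ → ∃ φ, IsTestFunction Ω φ ∧
    eLpNorm (v - φ) 1 (volume.restrict Ω) ≤ δ ∧
    eLpNorm (G - gradient φ) 1 (volume.restrict Ω) ≤ δ

namespace HasW011Gradient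

variable {v w : EuclideanSpace ℝ (Fin n) → ℝ}
  {G H : EuclideanSpace ℝ (Fin n) → EuclideanSpace ℝ (Fin n)}

theorem exists_seq (h : HasW011Gradient Ω v G) :
    ∃ φ : ℕ → EuclideanSpace ℝ (Fin n) → ℝ, (∀ k, IsTestFunction Ω (φ k)) ∧
      Tendsto (fun k => eLpNorm (v - φ k) 1 (volume.restrict Ω)) atTop (𝓝 0) ∧
      Tendsto (fun k => eLpNorm (G - gradient (φ k)) 1 (volume.restrict Ω)) atTop (𝓝 0) := by
  obtain ⟨u, -, hu0, hu⟩ := exists_seq_strictAnti_tendsto' (show (0 : ℝ≥0∞) < 1 by simp)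
  choose φ hφ h1 h2 using fun k => h.2.2 (u k) (hu0 k).1
  exact ⟨φ, hφ, tendsto_of_tendsto_of_tendsto_of_le_of_le tendsto_const_nhds hu
    (fun _ => zero_le) h1, tendsto_of_tendsto_of_tendsto_of_le_of_le tendsto_const_nhds hu
    (fun _ => zero_le) h2⟩

/-- A sequence of test functions that also converges almost everywhere. -/
theorem exists_seq_ae (h : HasW011Gradient Ω v G) :
    ∃ φ : ℕ → EuclideanSpace ℝ (Fin n) → ℝ, (∀ k, IsTestFunction Ω (φ k)) ∧
      Tendsto (fun k => eLpNorm (v - φ k) 1 (volume.restrict Ω)) atTop (𝓝 0) ∧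
      Tendsto (fun k => eLpNorm (G - gradient (φ k)) 1 (volume.restrict Ω)) atTop (𝓝 0) ∧
      ∀ᵐ x ∂(volume.restrict Ω), Tendsto (fun k => φ k x) atTop (𝓝 (v x)) := by
  obtain ⟨φ, hφ, h1, h2⟩ := h.exists_seq
  obtain ⟨ns, hns, hlim⟩ := exists_subseq_ae_tendsto_of_eLpNorm_one
    (fun k => (hφ k).integrable.aestronglyMeasurable.restrict) h.1.aestronglyMeasurable h1
  exact ⟨fun k => φ (ns k), fun k => hφ _, h1.comp hns.tendsto_atTop, h2.comp hns.tendsto_atTop,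
    hlim⟩

/-- Closedness of the relation in `L¹`. Later constructions produce the pair as an `L¹` limit and
need no test functions of their own. -/
theorem of_tendsto {V : ℕ → EuclideanSpace ℝ (Fin n) → ℝ}
    {K : ℕ → EuclideanSpace ℝ (Fin n) → EuclideanSpace ℝ (Fin n)}
    (hv : IntegrableOn v Ω) (hG : IntegrableOn G Ω)
    (h : ∀ k, HasW011Gradient Ω (V k) (K k))
    (h1 : Tendsto (fun k => eLpNorm (v - V k) 1 (volume.restrict Ω)) atTop (𝓝 0))
    (h2 : Tendsto (fun k => eLpNorm (G - K k) 1 (volume.restrict Ω)) atTop (𝓝 0)) :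
    HasW011Gradient Ω v G := by
  refine ⟨hv, hG, fun δ hδ => ?_⟩
  have hδ2 : 0 < δ / 2 := ENNReal.half_pos hδ.ne'
  obtain ⟨k, hk1, hk2⟩ := ((ENNReal.tendsto_nhds_zero.1 h1 _ hδ2).and
    (ENNReal.tendsto_nhds_zero.1 h2 _ hδ2)).exists
  obtain ⟨φ, hφ, hφ1, hφ2⟩ := (h k).2.2 _ hδ2
  refine ⟨φ, hφ, ?_, ?_⟩
  · calc eLpNorm (v - φ) 1 (volume.restrict Ω)
        = eLpNorm ((v - V k) + (V k - φ)) 1 (volume.restrict Ω) := by rw [sub_add_sub_cancel]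
      _ ≤ _ := eLpNorm_add_le (hv.sub (h k).1).aestronglyMeasurable
          ((h k).1.sub hφ.integrable.integrableOn).aestronglyMeasurable le_rfl
      _ ≤ δ / 2 + δ / 2 := add_le_add hk1 hφ1
      _ = δ := ENNReal.add_halves δ
  · calc eLpNorm (G - gradient φ) 1 (volume.restrict Ω)
        = eLpNorm ((G - K k) + (K k - gradient φ)) 1 (volume.restrict Ω) := by
          rw [sub_add_sub_cancel]
      _ ≤ _ := eLpNorm_add_le (hG.sub (h k).2.1).aestronglyMeasurable
          ((h k).2.1.sub hφ.integrable_gradient.integrableOn).aestronglyMeasurable le_rfl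
      _ ≤ δ / 2 + δ / 2 := add_le_add hk2 hφ2
      _ = δ := ENNReal.add_halves δ

theorem of_isTestFunction {φ : EuclideanSpace ℝ (Fin n) → ℝ} (hφ : IsTestFunction Ω φ) :
    HasW011Gradient Ω φ (gradient φ) :=
  ⟨hφ.integrable.integrableOn, hφ.integrable_gradient.integrableOn,
    fun δ _ => ⟨φ, hφ, by simp, by simp⟩⟩

theorem of_memW011 (h : MemW011 Ω v) : HasW011Gradient Ω v (weakGradient Ω v) := by
  obtain ⟨⟨hv, -, hG⟩, φ, hφ, h1, h2⟩ := h
  exact of_tendsto hv hG (fun k => of_isTestFunction (hφ k)) h1 h2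

theorem sub (hv : HasW011Gradient Ω v G) (hw : HasW011Gradient Ω w H) :
    HasW011Gradient Ω (fun x => v x - w x) (fun x => G x - H x) := by
  refine ⟨hv.1.sub hw.1, hv.2.1.sub hw.2.1, fun δ hδ => ?_⟩
  have hδ2 : 0 < δ / 2 := ENNReal.half_pos hδ.ne'
  obtain ⟨φ, hφ, h1, h2⟩ := hv.2.2 _ hδ2
  obtain ⟨ψ, hψ, h3, h4⟩ := hw.2.2 _ hδ2
  refine ⟨_, hφ.sub hψ, ?_, ?_⟩
  · calc _ = eLpNorm ((v - φ) - (w - ψ)) 1 (volume.restrict Ω) := by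
          congr 1; ext x; simp only [Pi.sub_apply]; ring
      _ ≤ _ := eLpNorm_sub_le (hv.1.sub hφ.integrable.integrableOn).aestronglyMeasurable
          (hw.1.sub hψ.integrable.integrableOn).aestronglyMeasurable le_rfl
      _ ≤ δ / 2 + δ / 2 := add_le_add h1 h3
      _ = δ := ENNReal.add_halves δ
  · calc _ = eLpNorm ((G - gradient φ) - (H - gradient ψ)) 1 (volume.restrict Ω) := by
          congr 1; ext1 x; simp only [Pi.sub_apply, hφ.gradient_sub hψ]; abel
      _ ≤ _ := eLpNorm_sub_le
          (hv.2.1.sub hφ.integrable_gradient.integrableOn).aestronglyMeasurable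
          (hw.2.1.sub hψ.integrable_gradient.integrableOn).aestronglyMeasurable le_rfl
      _ ≤ δ / 2 + δ / 2 := add_le_add h2 h4
      _ = δ := ENNReal.add_halves δ

/-- Integration by parts holds for the approximating test functions, and both sides pass to the
limit because `ψ` and its derivatives are bounded. -/
theorem hasWeakGradient (h : HasW011Gradient Ω v G) : HasWeakGradient Ω v G := by
  refine ⟨h.1.locallyIntegrableOn, h.2.1.locallyIntegrableOn, fun ψ hψ i => ?_⟩
  obtain ⟨φ, hφ, h1, h2⟩ := h.exists_seq
  have hd : Continuous fun x => fderiv ℝ ψ x (EuclideanSpace.single i 1) :=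
    hψ.continuous_fderiv.clm_apply continuous_const
  obtain ⟨C, hC⟩ := hψ.2.1.exists_bound_of_continuous hψ.1.continuous
  obtain ⟨C', hC'⟩ := (hψ.2.1.fderiv_apply ℝ (EuclideanSpace.single i 1)).exists_bound_of_continuous
    hd
  have hprod : ∀ {K : EuclideanSpace ℝ (Fin n) → ℝ} {b : EuclideanSpace ℝ (Fin n) → ℝ} {c : ℝ},
      IntegrableOn K Ω → Continuous b → (∀ x, ‖b x‖ ≤ c) → IntegrableOn (fun x => K x * b x) Ω := by
    intro K b c hK hb hc
    exact hK.mul_bdd hb.aestronglyMeasurable (Eventually.of_forall hc)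
  have hci : ∀ {K : EuclideanSpace ℝ (Fin n) → EuclideanSpace ℝ (Fin n)},
      IntegrableOn K Ω → IntegrableOn (fun x => K x i) Ω :=
    fun hK => (EuclideanSpace.proj (𝕜 := ℝ) i).integrable_comp hK
  have t1 : Tendsto (fun k => ∫ x in Ω, φ k x * fderiv ℝ ψ x (EuclideanSpace.single i 1)) atTop
      (𝓝 (∫ x in Ω, v x * fderiv ℝ ψ x (EuclideanSpace.single i 1))) := by
    refine tendsto_integral_of_L1' _ (hprod h.1 hd hC').aestronglyMeasurable
      (Eventually.of_forall fun k => hprod (hφ k).integrable.integrableOn hd hC') ?_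
    refine tendsto_of_tendsto_of_tendsto_of_le_of_le tendsto_const_nhds
      (by simpa using ENNReal.Tendsto.const_mul h1 (Or.inr (ENNReal.ofReal_ne_top (r := C'))))
      (fun _ => zero_le) fun k => ?_
    refine eLpNorm_le_mul_eLpNorm_of_ae_le_mul (Eventually.of_forall fun x => ?_) 1
    simp only [Pi.sub_apply]
    rw [← sub_mul, norm_mul, mul_comm, norm_sub_rev]
    exact mul_le_mul_of_nonneg_right (hC' x) (norm_nonneg _)
  have t2 : Tendsto (fun k => ∫ x in Ω, gradient (φ k) x i * ψ x) atTop
      (𝓝 (∫ x in Ω, G x i * ψ x)) := by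
    refine tendsto_integral_of_L1' _ (hprod (hci h.2.1) hψ.1.continuous hC).aestronglyMeasurable
      (Eventually.of_forall fun k => hprod (hci (hφ k).integrable_gradient.integrableOn)
        hψ.1.continuous hC) ?_
    refine tendsto_of_tendsto_of_tendsto_of_le_of_le tendsto_const_nhds
      (by simpa using ENNReal.Tendsto.const_mul h2 (Or.inr (ENNReal.ofReal_ne_top (r := C))))
      (fun _ => zero_le) fun k => ?_
    refine eLpNorm_le_mul_eLpNorm_of_ae_le_mul (Eventually.of_forall fun x => ?_) 1
    simp only [Pi.sub_apply]
    rw [← sub_mul, norm_mul, mul_comm, norm_sub_rev (G x)]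
    exact mul_le_mul (hC x) (PiLp.norm_apply_le (gradient (φ k) x - G x) i) (norm_nonneg _)
      ((norm_nonneg _).trans (hC x))
  refine tendsto_nhds_unique t1 (t2.neg.congr fun k => ?_)
  have hz : ∀ x, x ∉ Ω → ψ x = 0 ∧ fderiv ℝ ψ x = 0 := fun x hx =>
    ⟨image_eq_zero_of_notMem_tsupport fun h => hx (hψ.2.2 h),
      image_eq_zero_of_notMem_tsupport fun h => hx (hψ.2.2 (tsupport_fderiv_subset ℝ h))⟩
  rw [setIntegral_eq_integral_of_forall_compl_eq_zero fun x hx => by simp [(hz x hx).1],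
    setIntegral_eq_integral_of_forall_compl_eq_zero fun x hx => by simp [(hz x hx).2]]
  simp only [gradient_apply_eq_fderiv_single]
  have hdφ : Continuous fun x => fderiv ℝ (φ k) x (EuclideanSpace.single i 1) :=
    (hφ k).continuous_fderiv.clm_apply continuous_const
  refine (integral_mul_fderiv_eq_neg_fderiv_mul_of_integrable ?_ ?_ ?_
    (fun x _ => (hφ k).differentiable x) (fun x _ => hψ.differentiable x)).symm
  · exact (hdφ.mul hψ.1.continuous).integrable_of_hasCompactSupport hψ.2.1.mul_left
  · exact ((hφ k).1.continuous.mul hd).integrable_of_hasCompactSupport (hφ k).2.1.mul_right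
  · exact ((hφ k).1.continuous.mul hψ.1.continuous).integrable_of_hasCompactSupport hψ.2.1.mul_left

theorem congr (h : HasW011Gradient Ω v G) (hGH : G =ᵐ[volume.restrict Ω] H) :
    HasW011Gradient Ω v H := by
  refine ⟨h.1, h.2.1.congr hGH, fun δ hδ => ?_⟩
  obtain ⟨φ, hφ, h1, h2⟩ := h.2.2 δ hδ
  exact ⟨φ, hφ, h1, (eLpNorm_congr_ae (hGH.symm.sub (ae_eq_refl _))).trans_le h2⟩

theorem memW011 (hΩ : IsOpen Ω) (h : HasW011Gradient Ω v G) : MemW011 Ω v := by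
  have hw := h.hasWeakGradient.weakGradient
  have h' := h.congr (h.hasWeakGradient.ae_eq hΩ hw)
  obtain ⟨φ, hφ, h1, h2⟩ := h'.exists_seq
  exact ⟨⟨h.1, hw, h'.2.1⟩, φ, hφ, h1, h2⟩

end HasW011Gradient

end SobolevSpace

/-! ### Chain rule and truncation in `W₀^{1,1}`. -/

section Truncation

variable {n : ℕ} {Ω : Set (EuclideanSpace ℝ (Fin n))}
  {v : EuclideanSpace ℝ (Fin n) → ℝ} {G : EuclideanSpace ℝ (Fin n) → EuclideanSpace ℝ (Fin n)}

theorem abs_sub_le_of_abs_deriv_le_one {η : ℝ → ℝ} (hη : Differentiable ℝ η)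
    (h : ∀ t, |deriv η t| ≤ 1) (s t : ℝ) : |η s - η t| ≤ |s - t| := by
  simpa using Convex.norm_image_sub_le_of_norm_deriv_le (fun x _ => hη x) (fun x _ => h x)
    convex_univ (mem_univ t) (mem_univ s)

theorem integral_indicator_Icc_neg {k : ℝ} (hk : 0 ≤ k) (t : ℝ) :
    ∫ s in (0 : ℝ)..t, (Icc (-k) k).indicator (fun _ => (1 : ℝ)) s = max (-k) (min k t) := by
  rcases le_total 0 t with ht | ht
  · rw [intervalIntegral.integral_of_le ht, integral_indicator measurableSet_Icc,
      Measure.restrict_restrict measurableSet_Icc]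
    have : Icc (-k) k ∩ Ioc 0 t = Ioc 0 (min k t) := by
      ext x; simp only [mem_inter_iff, mem_Icc, mem_Ioc, le_min_iff]
      constructor
      · rintro ⟨⟨-, h⟩, h1, h2⟩; exact ⟨h1, h, h2⟩
      · rintro ⟨h1, h, h2⟩; exact ⟨⟨by linarith, h⟩, h1, h2⟩
    have h0 : 0 ≤ min k t := le_min hk ht
    rw [this, max_eq_right (by linarith)]
    simp [h0]
  · rw [intervalIntegral.integral_of_ge ht, integral_indicator measurableSet_Icc,
      Measure.restrict_restrict measurableSet_Icc]
    rw [min_eq_right (ht.trans hk)]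
    have : (Icc (-k) k ∩ Ioc t 0 : Set ℝ) =ᵐ[volume] Ioc (max (-k) t) 0 := by
      have : (Icc (-k) k ∩ Ioc t 0 : Set ℝ) =ᵐ[volume] (Ioc (-k) k ∩ Ioc t 0 : Set ℝ) :=
        Ioc_ae_eq_Icc.symm.inter (ae_eq_refl _)
      refine this.trans (Eq.eventuallyEq (Set.ext fun x => ?_))
      simp only [mem_inter_iff, mem_Ioc, max_lt_iff]
      constructor
      · rintro ⟨⟨h, -⟩, h1, h2⟩; exact ⟨⟨h, h1⟩, h2⟩
      · rintro ⟨⟨h, h1⟩, h2⟩; exact ⟨⟨h, by linarith⟩, h1, h2⟩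
    have h0 : max (-k) t ≤ 0 := max_le (by linarith) ht
    rw [setIntegral_congr_set this]
    simp [h0]

/-- Smooth approximations of the truncation at the levels `±k`, together with their derivatives. -/
theorem exists_smooth_truncation {k : ℝ} (hk : 0 ≤ k) :
    ∃ η : ℕ → ℝ → ℝ, (∀ j, ContDiff ℝ ∞ (η j)) ∧ (∀ j, η j 0 = 0) ∧
      (∀ j t, |deriv (η j) t| ≤ 1) ∧
      (∀ t, Tendsto (fun j => η j t) atTop (𝓝 (max (-k) (min k t)))) ∧
      ∀ t, Tendsto (fun j => deriv (η j) t) atTop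
        (𝓝 ((Icc (-k) k).indicator (fun _ => (1 : ℝ)) t)) := by
  -- The derivatives of the `η j`. The summand `1` makes the value exactly `1` on the closed
  -- interval, endpoints included, so they converge everywhere to the indicator of `[-k, k]`;
  -- nothing need be known about `G` on `{|v| = k}`.
  set θ : ℕ → ℝ → ℝ := fun j t => Real.smoothTransition (1 + j * (k ^ 2 - t ^ 2)) with hθ
  have hθc : ∀ j, ContDiff ℝ ∞ (θ j) := fun j =>
    (Real.smoothTransition.contDiff (n := ⊤)).comp (by fun_prop)
  have hd : ∀ j t, HasDerivAt (fun t => ∫ s in (0 : ℝ)..t, θ j s) (θ j t) t := fun j t =>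
    intervalIntegral.integral_hasDerivAt_right ((hθc j).continuous.intervalIntegrable _ _)
      ((hθc j).continuous.stronglyMeasurableAtFilter _ _) (hθc j).continuous.continuousAt
  have hderiv : ∀ j, deriv (fun t => ∫ s in (0 : ℝ)..t, θ j s) = θ j := fun j =>
    funext fun t => (hd j t).deriv
  have hθ1 : ∀ j t, |θ j t| ≤ 1 := fun j t => by
    rw [abs_of_nonneg (Real.smoothTransition.nonneg _)]
    exact Real.smoothTransition.le_one _
  have hθlim : ∀ t, Tendsto (fun j => θ j t) atTop
      (𝓝 ((Icc (-k) k).indicator (fun _ => (1 : ℝ)) t)) := by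
    intro t
    by_cases ht : t ∈ Icc (-k) k
    · rw [indicator_of_mem ht]
      refine tendsto_const_nhds.congr fun j => (Real.smoothTransition.one_of_one_le ?_).symm
      have : t ^ 2 ≤ k ^ 2 := sq_le_sq' ht.1 ht.2
      have : 0 ≤ (j : ℝ) * (k ^ 2 - t ^ 2) := by
        apply mul_nonneg (Nat.cast_nonneg j); linarith
      linarith
    · rw [indicator_of_notMem ht]
      have hlt : k ^ 2 < t ^ 2 := by
        rw [sq_lt_sq, abs_of_nonneg hk]
        by_contra hcon
        exact ht (abs_le.1 (not_lt.1 hcon))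
      have h1 : Tendsto (fun j : ℕ => (j : ℝ) * (t ^ 2 - k ^ 2)) atTop atTop :=
        tendsto_natCast_atTop_atTop.atTop_mul_const (by linarith)
      refine tendsto_const_nhds.congr' ?_
      filter_upwards [h1.eventually_ge_atTop 1] with j hj
      refine (Real.smoothTransition.zero_of_nonpos ?_).symm
      linarith
  refine ⟨fun j t => ∫ s in (0 : ℝ)..t, θ j s, fun j => ?_, fun j => by simp, fun j t => ?_,
    fun t => ?_, fun t => ?_⟩
  · rw [contDiff_infty_iff_deriv, hderiv]
    exact ⟨fun t => (hd j t).differentiableAt, hθc j⟩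
  · rw [hderiv]; exact hθ1 j t
  · rw [← integral_indicator_Icc_neg hk]
    refine intervalIntegral.tendsto_integral_filter_of_dominated_convergence (fun _ => 1)
      (Eventually.of_forall fun j => (hθc j).continuous.aestronglyMeasurable)
      (Eventually.of_forall fun j => ae_of_all _ fun s _ => hθ1 j s)
      intervalIntegrable_const (ae_of_all _ fun s _ => hθlim s)
  · simp only [hderiv]; exact hθlim t

namespace HasW011Gradient

theorem comp_smooth (h : HasW011Gradient Ω v G) {η : ℝ → ℝ} (hη : ContDiff ℝ ∞ η)
    (h0 : η 0 = 0) (h1 : ∀ t, |deriv η t| ≤ 1) :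
    HasW011Gradient Ω (fun x => η (v x)) (fun x => deriv η (v x) • G x) := by
  have hd : Continuous (deriv η) := hη.continuous_deriv (by simp)
  have hdiff : Differentiable ℝ η := hη.differentiable (by simp)
  have hlip := abs_sub_le_of_abs_deriv_le_one hdiff h1
  obtain ⟨φ, hφ, hφ1, hφ2, hae⟩ := h.exists_seq_ae
  have hint : IntegrableOn (fun x => η (v x)) Ω := by
    refine Integrable.mono h.1 (hη.continuous.comp_aestronglyMeasurable h.1.aestronglyMeasurable)
      (ae_of_all _ fun x => ?_)
    simpa [h0] using hlip (v x) 0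
  have hsm : ∀ {w : EuclideanSpace ℝ (Fin n) → ℝ}, AEStronglyMeasurable w (volume.restrict Ω) →
      IntegrableOn (fun x => deriv η (w x) • G x) Ω := fun hw =>
    h.2.1.bdd_smul 1 (hd.comp_aestronglyMeasurable hw) (ae_of_all _ fun x => h1 _)
  have hφm : ∀ k, AEStronglyMeasurable (φ k) (volume.restrict Ω) := fun k =>
    (hφ k).integrable.aestronglyMeasurable.restrict
  refine of_tendsto hint (hsm h.1.aestronglyMeasurable)
    (fun k => of_isTestFunction ((hφ k).comp_left hη h0)) ?_ ?_
  · refine tendsto_of_tendsto_of_tendsto_of_le_of_le tendsto_const_nhds hφ1 (fun _ => zero_le)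
      fun k => eLpNorm_mono fun x => hlip _ _
  -- The error splits as `(η'(v) - η'(φ_k)) G + η'(φ_k) (G - ∇φ_k)`: dominated convergence handles
  -- the first term, `|η'| ≤ 1` the second.
  · have hA : Tendsto (fun k => eLpNorm ((fun x => deriv η (v x) • G x) -
        fun x => deriv η (φ k x) • G x) 1 (volume.restrict Ω)) atTop (𝓝 0) := by
      refine tendsto_eLpNorm_one_sub_of_dominated (fun k => (hsm (hφm k)).aestronglyMeasurable)
        h.2.1.norm (fun k => ae_of_all _ fun x => ?_) ?_
      · rw [norm_smul]
        exact mul_le_of_le_one_left (norm_nonneg _) (h1 _)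
      · filter_upwards [hae] with x hx
        exact ((hd.tendsto _).comp hx).smul_const _
    have hsum := hA.add hφ2
    rw [add_zero] at hsum
    refine tendsto_of_tendsto_of_tendsto_of_le_of_le tendsto_const_nhds hsum (fun _ => zero_le)
      fun k => ?_
    have hB : eLpNorm (fun x => deriv η (φ k x) • (G x - gradient (φ k) x)) 1 (volume.restrict Ω)
        ≤ eLpNorm (G - gradient (φ k)) 1 (volume.restrict Ω) := by
      refine eLpNorm_mono fun x => ?_
      rw [norm_smul]
      exact mul_le_of_le_one_left (norm_nonneg _) (h1 _)
    refine le_trans (le_of_eq ?_) ((eLpNorm_add_le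
      ((hsm h.1.aestronglyMeasurable).sub (hsm (hφm k))).aestronglyMeasurable
      ?_ le_rfl).trans (add_le_add le_rfl hB))
    · congr 1
      ext1 x
      simp only [Pi.sub_apply, Pi.add_apply, (hφ k).gradient_comp_left hη, smul_sub]
      abel
    · exact (hd.comp_aestronglyMeasurable (hφm k)).smul
        (h.2.1.sub (hφ k).integrable_gradient.integrableOn).aestronglyMeasurable

/-- Stampacchia's theorem for the truncation at the levels `±k`. -/
theorem truncation (h : HasW011Gradient Ω v G) {k : ℝ} (hk : 0 ≤ k) :
    HasW011Gradient Ω (fun x => max (-k) (min k (v x)))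
      (fun x => (Icc (-k) k).indicator (fun _ => (1 : ℝ)) (v x) • G x) := by
  obtain ⟨η, hη, h0, h1, hlim, hdlim⟩ := exists_smooth_truncation hk
  have hcomp := fun j => h.comp_smooth (hη j) (h0 j) (h1 j)
  have hvm := h.1.aestronglyMeasurable
  refine of_tendsto ?_ ?_ hcomp ?_ ?_
  · refine Integrable.mono h.1
      ((by fun_prop : Continuous fun t : ℝ => max (-k) (min k t)).comp_aestronglyMeasurable hvm)
      (ae_of_all _ fun x => ?_)
    rw [Real.norm_eq_abs, Real.norm_eq_abs, abs_le]
    have h2 := neg_abs_le (v x)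
    have h3 := le_abs_self (v x)
    exact ⟨le_max_of_le_right (le_min (by linarith [abs_nonneg (v x)]) h2),
      max_le (by linarith [abs_nonneg (v x)]) ((min_le_right _ _).trans h3)⟩
  · have hm : AEStronglyMeasurable (fun x => (Icc (-k) k).indicator (fun _ => (1 : ℝ)) (v x))
        (volume.restrict Ω) := ((measurable_const.indicator measurableSet_Icc).comp_aemeasurable
      hvm.aemeasurable).aestronglyMeasurable
    exact h.2.1.bdd_smul 1 hm
      (ae_of_all _ fun x => (norm_indicator_le_norm_self _ _).trans (by simp))
  · refine tendsto_eLpNorm_one_sub_of_dominated (fun j => (hcomp j).1.aestronglyMeasurable)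
      h.1.norm (fun j => ae_of_all _ fun x => ?_) (ae_of_all _ fun x => hlim _)
    simpa [h0] using abs_sub_le_of_abs_deriv_le_one ((hη j).differentiable (by simp)) (h1 j) (v x) 0
  · refine tendsto_eLpNorm_one_sub_of_dominated (fun j => (hcomp j).2.1.aestronglyMeasurable)
      h.2.1.norm (fun j => ae_of_all _ fun x => ?_)
      (ae_of_all _ fun x => (hdlim _).smul_const _)
    rw [norm_smul]
    exact mul_le_of_le_one_left (norm_nonneg _) (h1 j _)

end HasW011Gradient

end Truncation

/-! ### The Sobolev inequality for `p = 1`, on level sets. -/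

section SobolevInequality

/-- The Sobolev inequality in `W₀^{1,1}(Ω)`. -/
theorem HasW011Gradient.exists_eLpNorm_le {n : ℕ} (hn : 2 ≤ n) :
    ∃ S : ℝ≥0∞, S ≠ ⊤ ∧ ∀ (Ω : Set (EuclideanSpace ℝ (Fin n))) (w : EuclideanSpace ℝ (Fin n) → ℝ)
      (G : EuclideanSpace ℝ (Fin n) → EuclideanSpace ℝ (Fin n)), MeasurableSet Ω →
      HasW011Gradient Ω w G →
      eLpNorm w (ENNReal.ofReal (n / (n - 1))) (volume.restrict Ω) ≤
        S * eLpNorm G 1 (volume.restrict Ω) := by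
  have hn1 : (1 : ℝ) < n := by exact_mod_cast hn
  have hq : 0 ≤ (n : ℝ) / (n - 1) := div_nonneg (by linarith) (by linarith)
  have hconj : NNReal.HolderConjugate
      (Module.finrank ℝ (EuclideanSpace ℝ (Fin n)) : NNReal) (Real.toNNReal (n / (n - 1))) := by
    rw [finrank_euclideanSpace_fin, ← NNReal.holderConjugate_coe_iff,
      Real.coe_toNNReal _ hq]
    simpa [Real.conjExponent] using Real.HolderConjugate.conjExponent hn1
  refine ⟨(eLpNormLESNormFDerivOneConst (volume : Measure (EuclideanSpace ℝ (Fin n)))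
    (Real.toNNReal (n / (n - 1)))), ENNReal.coe_ne_top, fun Ω w G hΩ h => ?_⟩
  set S : ℝ≥0∞ := (eLpNormLESNormFDerivOneConst (volume : Measure (EuclideanSpace ℝ (Fin n)))
    (Real.toNNReal (n / (n - 1))) : ℝ≥0∞) with hS
  obtain ⟨φ, hφ, h1, h2, hae⟩ := h.exists_seq_ae
  have hbound : ∀ k, eLpNorm (φ k) (ENNReal.ofReal (n / (n - 1))) (volume.restrict Ω) ≤
      S * (eLpNorm G 1 (volume.restrict Ω) +
        eLpNorm (G - gradient (φ k)) 1 (volume.restrict Ω)) := by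
    intro k
    refine (eLpNorm_mono_measure _ Measure.restrict_le_self).trans
      ((eLpNorm_le_eLpNorm_fderiv_one volume ((hφ k).1.of_le (by simp)) (hφ k).2.1 hconj).trans ?_)
    refine mul_le_mul_right ?_ S
    -- Derivatives of test functions vanish off `Ω`, so the inequality on the whole space localizes.
    have hind : eLpNorm (fderiv ℝ (φ k)) 1 volume
        = eLpNorm (gradient (φ k)) 1 (volume.restrict Ω) := by
      rw [← eLpNorm_indicator_eq_eLpNorm_restrict hΩ]
      refine eLpNorm_congr_norm_ae (ae_of_all _ fun x => ?_)
      by_cases hx : x ∈ Ω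
      · rw [indicator_of_mem hx, norm_gradient_eq_norm_fderiv]
      · rw [indicator_of_notMem hx, image_eq_zero_of_notMem_tsupport fun h =>
          hx ((hφ k).2.2 (tsupport_fderiv_subset ℝ h))]
        simp
    rw [hind]
    calc eLpNorm (gradient (φ k)) 1 (volume.restrict Ω)
        = eLpNorm (G - (G - gradient (φ k))) 1 (volume.restrict Ω) := by rw [sub_sub_cancel]
      _ ≤ _ := eLpNorm_sub_le h.2.1.aestronglyMeasurable
        (h.2.1.sub (hφ k).integrable_gradient.integrableOn).aestronglyMeasurable le_rfl
  -- Fatou's lemma along the sequence converging almost everywhere.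
  refine (Lp.eLpNorm_lim_le_liminf_eLpNorm
    (fun k => (hφ k).integrable.aestronglyMeasurable.restrict) w hae).trans
    ((liminf_le_liminf (Eventually.of_forall hbound)).trans (le_of_eq ?_))
  refine Tendsto.liminf_eq ?_
  have := ENNReal.Tendsto.const_mul (a := S) (h2.const_add (eLpNorm G 1 (volume.restrict Ω)))
    (Or.inr ENNReal.coe_ne_top)
  simpa using this

end SobolevInequality

section LevelSets

/-- Chebyshev's inequality in `L^{n/(n-1)}` combined with the Sobolev inequality. -/
theorem HasW011Gradient.exists_mul_rpow_measureReal_le {n : ℕ} (hn : 2 ≤ n) :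
    ∃ S : ℝ, 0 < S ∧ ∀ (Ω : Set (EuclideanSpace ℝ (Fin n))) (w : EuclideanSpace ℝ (Fin n) → ℝ)
      (G : EuclideanSpace ℝ (Fin n) → EuclideanSpace ℝ (Fin n)), MeasurableSet Ω →
      HasW011Gradient Ω w G → ∀ t, 0 < t →
      t * ((volume.restrict Ω).real {x | t ≤ |w x|}) ^ (1 - 1 / (n : ℝ)) ≤
        S * ∫ x in Ω, ‖G x‖ := by
  obtain ⟨S, hS, h⟩ := HasW011Gradient.exists_eLpNorm_le hn
  refine ⟨S.toReal + 1, by positivity, fun Ω w G hΩ hw t ht => ?_⟩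
  have hn1 : (1 : ℝ) < n := by exact_mod_cast hn
  have hq : 0 < (n : ℝ) / (n - 1) := div_pos (by linarith) (by linarith)
  have hqr : (ENNReal.ofReal ((n : ℝ) / (n - 1))).toReal = n / (n - 1) :=
    ENNReal.toReal_ofReal hq.le
  have hα : 1 / ((n : ℝ) / (n - 1)) = 1 - 1 / n := by
    have : (n : ℝ) ≠ 0 := by linarith
    field_simp
  have h1 := mul_meas_ge_le_pow_eLpNorm' (volume.restrict Ω)
    (p := ENNReal.ofReal ((n : ℝ) / (n - 1)))
    (by simpa using hq) ENNReal.ofReal_ne_top hw.1.aestronglyMeasurable (ENNReal.ofReal t)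
  rw [hqr] at h1
  have h2 := ENNReal.rpow_le_rpow h1 (z := 1 / ((n : ℝ) / (n - 1))) (by positivity)
  rw [ENNReal.mul_rpow_of_nonneg _ _ (by positivity), ← ENNReal.rpow_mul, ← ENNReal.rpow_mul,
    mul_one_div_cancel hq.ne', ENNReal.rpow_one, ENNReal.rpow_one, hα] at h2
  have h3 := h2.trans (h Ω w G hΩ hw)
  have hfin : eLpNorm G 1 (volume.restrict Ω) ≠ ⊤ := by
    rw [eLpNorm_one_eq_lintegral_enorm]
    exact hw.2.1.2.ne
  have h4 := ENNReal.toReal_mono (ENNReal.mul_ne_top hS hfin) h3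
  rw [ENNReal.toReal_mul, ENNReal.toReal_mul, ← ENNReal.toReal_rpow, ENNReal.toReal_ofReal ht.le,
    eLpNorm_one_eq_lintegral_enorm, ← integral_norm_eq_lintegral_enorm hw.2.1.aestronglyMeasurable]
    at h4
  have hset : {x | ENNReal.ofReal t ≤ ‖w x‖ₑ} = {x | t ≤ |w x|} := by
    ext x
    rw [mem_ofPred_eq, mem_ofPred_eq, ← ofReal_norm,
      ENNReal.ofReal_le_ofReal_iff (norm_nonneg _), Real.norm_eq_abs]
  rw [hset] at h4
  refine h4.trans (mul_le_mul_of_nonneg_right (by linarith)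
    (integral_nonneg fun _ => norm_nonneg _))

theorem nullMeasurableSet_lt_abs {α : Type*} {m : MeasurableSpace α} {μ : Measure α} {v : α → ℝ}
    (hv : AEStronglyMeasurable v μ) (k : ℝ) : NullMeasurableSet {x | k < |v x|} μ :=
  nullMeasurableSet_lt aemeasurable_const hv.norm.aemeasurable

/-- The Sobolev inequality on the level sets of a function in `W₀^{1,1}(Ω)`. -/
theorem HasW011Gradient.exists_level_set_inequality {n : ℕ} (hn : 2 ≤ n) :
    ∃ S : ℝ, 0 < S ∧ ∀ (Ω : Set (EuclideanSpace ℝ (Fin n))) (v : EuclideanSpace ℝ (Fin n) → ℝ)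
      (G : EuclideanSpace ℝ (Fin n) → EuclideanSpace ℝ (Fin n)), MeasurableSet Ω →
      HasW011Gradient Ω v G → volume Ω ≠ ⊤ → ∀ k h, 0 ≤ k → k < h →
      (h - k) * ((volume.restrict Ω).real {x | h < |v x|}) ^ (1 - 1 / (n : ℝ)) ≤
        S * ∫ x in {x | k < |v x|}, ‖G x‖ ∂(volume.restrict Ω) := by
  obtain ⟨S, hS, hSob⟩ := HasW011Gradient.exists_mul_rpow_measureReal_le hn
  refine ⟨S, hS, fun Ω v G hΩ hv hfin k h hk hkh => ?_⟩
  have := Fact.mk hfin.lt_top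
  have hn1 : (1 : ℝ) < n := by exact_mod_cast hn
  -- The difference of the truncations at `h` and `k` has modulus `h - k` where `|v| > h`; its
  -- gradient vanishes where `|v| ≤ k` and is dominated by `|G|` elsewhere.
  have hw := (hv.truncation (hk.trans hkh.le)).sub (hv.truncation hk)
  have h1 := hSob Ω _ _ hΩ hw (h - k) (sub_pos.2 hkh)
  have hα : 0 ≤ 1 - 1 / (n : ℝ) := by
    rw [sub_nonneg, div_le_one (by linarith)]; exact hn1.le
  refine (mul_le_mul_of_nonneg_left ?_ (sub_pos.2 hkh).le).trans
    (h1.trans (mul_le_mul_of_nonneg_left ?_ hS.le))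
  · refine Real.rpow_le_rpow measureReal_nonneg (measureReal_mono fun x hx => ?_) hα
    rw [mem_ofPred_eq] at hx ⊢
    rcases lt_abs.1 hx with hx | hx
    · rw [min_eq_left hx.le, min_eq_left (hkh.trans hx).le, max_eq_right (by linarith),
        max_eq_right (by linarith)]
      exact le_abs_self _
    · rw [min_eq_right (by linarith), min_eq_right (by linarith), max_eq_left (by linarith),
        max_eq_left (by linarith)]
      exact (by linarith : h - k ≤ -(-h - -k)).trans (neg_le_abs _)
  · rw [← integral_indicator₀ (nullMeasurableSet_lt_abs hv.1.aestronglyMeasurable k)]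
    refine integral_mono hw.2.1.norm
      (hv.2.1.norm.indicator₀ (nullMeasurableSet_lt_abs hv.1.aestronglyMeasurable k)) fun x => ?_
    have hmem : ∀ l, v x ∈ Icc (-l) l ↔ |v x| ≤ l := fun l => abs_le.symm
    by_cases hx : k < |v x|
    · rw [indicator_of_mem (a := x) (s := {x | k < |v x|}) hx,
        indicator_of_notMem (a := v x) (s := Icc (-k) k)
        (by rw [hmem]; linarith), zero_smul, sub_zero, norm_smul]
      exact mul_le_of_le_one_left (norm_nonneg _)
        ((norm_indicator_le_norm_self _ _).trans (by simp))
    · rw [indicator_of_mem (a := v x) (s := Icc (-k) k) (by rw [hmem]; linarith),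
        indicator_of_mem (a := v x) (s := Icc (-h) h) (by rw [hmem]; linarith), sub_self, norm_zero]
      exact indicator_nonneg (fun _ _ => norm_nonneg _) x

end LevelSets

/-! ### Consequences of the convexity of `g`. -/

namespace IsGrowthFunction

variable {g : ℝ → ℝ} {μ : ℝ}

theorem nonneg (hg : IsGrowthFunction g μ) {t : ℝ} (ht : 0 ≤ t) : 0 ≤ g t := by
  rcases ht.eq_or_lt with rfl | h
  · rw [hg.map_zero]
  · exact (hg.pos t h).le

theorem continuous_comp_abs (hg : IsGrowthFunction g μ) : Continuous fun t => g |t| :=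
  hg.contDiffOn.continuousOn.comp_continuous continuous_abs fun t => abs_nonneg t

/-- A convex function lies above its tangent at `0`; the slope there is positive. -/
theorem exists_mul_le (hg : IsGrowthFunction g μ) : ∃ c, 0 < c ∧ ∀ t, 0 ≤ t → c * t ≤ g t := by
  refine ⟨_, hg.deriv_zero_pos, fun t ht => ?_⟩
  rcases ht.eq_or_lt with rfl | h
  · simp [hg.map_zero]
  · have := hg.convexOn.derivWithin_le_slope (x := 0) (y := t) (by simp) ht h
      ((hg.contDiffOn.differentiableOn (by simp)) 0 (by simp))
    rw [slope_def_field, hg.map_zero, sub_zero, sub_zero, le_div_iff₀ h] at this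
    exact this

/-- Monotonicity of `g(t)/t`, written without division: `s` is a convex combination of `t` and `0`.
-/
theorem mul_le_mul_of_le (hg : IsGrowthFunction g μ) {s t : ℝ} (hs : 0 ≤ s) (hst : s ≤ t) :
    t * g s ≤ s * g t := by
  rcases (hs.trans hst).eq_or_lt with h | ht
  · have : s = 0 := le_antisymm (hst.trans h.ge) hs
    rw [← h, this]
  · have h1 := hg.convexOn.2 (show t ∈ Ici (0 : ℝ) from ht.le) (show (0 : ℝ) ∈ Ici (0 : ℝ) by simp)
      (show 0 ≤ s / t by positivity)
      (show 0 ≤ 1 - s / t by rw [sub_nonneg, div_le_one ht]; exact hst) (by ring)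
    simp only [smul_eq_mul, mul_zero, add_zero, hg.map_zero] at h1
    rw [div_mul_cancel₀ _ ht.ne', div_mul_eq_mul_div, le_div_iff₀ ht] at h1
    linarith

theorem strictMonoOn (hg : IsGrowthFunction g μ) : StrictMonoOn g (Ici 0) := by
  intro s hs t ht hst
  rcases (show (0 : ℝ) ≤ s from hs).eq_or_lt with h | h
  · rw [← h, hg.map_zero]; exact hg.pos t (h ▸ hst)
  · have h1 := hg.mul_le_mul_of_le h.le hst.le
    have h2 := hg.pos s h
    by_contra! hcon
    nlinarith

theorem exists_eq (hg : IsGrowthFunction g μ) {y : ℝ} (hy : 0 < y) : ∃ s, 0 < s ∧ g s = y := by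
  obtain ⟨c, hc, h⟩ := hg.exists_mul_le
  have hyc : 0 ≤ y / c := by positivity
  have h1 := h (y / c) hyc
  rw [mul_div_cancel₀ _ hc.ne'] at h1
  obtain ⟨s, hs, rfl⟩ := intermediate_value_Icc hyc
    (hg.contDiffOn.continuousOn.mono fun x hx => hx.1) ⟨hg.map_zero.trans_le hy.le, h1⟩
  refine ⟨s, hs.1.lt_of_ne fun h => ?_, rfl⟩
  rw [← h, hg.map_zero] at hy
  exact hy.false

/-- For `t ≥ s` the ratio `g t / g s` is at least both `t / s` and `1`, so raising it to the power
`p` only increases it. The free parameter `s` is optimized later. -/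
theorem le_add_mul_rpow_div (hg : IsGrowthFunction g μ) {p s t : ℝ} (hp : 1 ≤ p) (hs : 0 < s)
    (ht : 0 ≤ t) : t ≤ s + s * (g t ^ p / g s ^ p) := by
  have hgs := hg.pos s hs
  have hgt := hg.nonneg ht
  rcases le_total t s with h | h
  · have : 0 ≤ s * (g t ^ p / g s ^ p) := by positivity
    linarith
  · have h1 := hg.mul_le_mul_of_le hs.le h
    have h2 : t ≤ s * (g t / g s) := by
      rw [← mul_div_assoc, le_div_iff₀ hgs]; exact h1
    have h3 : 1 ≤ g t / g s := by
      rw [one_le_div hgs]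
      exact hg.monotoneOn hs.le ht h
    have h4 : g t / g s ≤ g t ^ p / g s ^ p := by
      rw [← Real.div_rpow hgt hgs.le]
      exact Real.self_le_rpow_of_one_le h3 hp
    nlinarith [mul_le_mul_of_nonneg_left h4 hs.le]

end IsGrowthFunction

/-! ### Minimality tested with truncations. -/

section Energy

variable {n : ℕ} {Ω : Set (EuclideanSpace ℝ (Fin n))}

theorem HasWeakGradient.add {u w : EuclideanSpace ℝ (Fin n) → ℝ}
    {G H : EuclideanSpace ℝ (Fin n) → EuclideanSpace ℝ (Fin n)}
    (hu : HasWeakGradient Ω u G) (hw : HasWeakGradient Ω w H) :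
    HasWeakGradient Ω (fun x => u x + w x) (fun x => G x + H x) := by
  refine ⟨hu.1.add hw.1, hu.2.1.add hw.2.1, fun φ hφ i => ?_⟩
  have hprod : ∀ {K b : EuclideanSpace ℝ (Fin n) → ℝ}, LocallyIntegrableOn K Ω → Continuous b →
      (∀ x, x ∉ tsupport φ → b x = 0) → IntegrableOn (fun x => K x * b x) Ω := by
    intro K b hK hb h0
    refine Integrable.integrableOn ?_
    rw [← integrableOn_iff_integrable_of_support_subset (s := tsupport φ)]
    · exact (hK.integrableOn_compact_subset hφ.2.2 hφ.2.1).mul_continuousOn hb.continuousOn hφ.2.1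
    · intro x hx
      by_contra hcon
      exact hx (by simp [h0 x hcon])
  have hcoord : ∀ {K : EuclideanSpace ℝ (Fin n) → EuclideanSpace ℝ (Fin n)},
      LocallyIntegrableOn K Ω → LocallyIntegrableOn (fun x => K x i) Ω := by
    intro K hK x hx
    obtain ⟨s, hs, hi⟩ := hK x hx
    exact ⟨s, hs, (EuclideanSpace.proj (𝕜 := ℝ) i).integrable_comp hi⟩
  have hd : Continuous fun x => fderiv ℝ φ x (EuclideanSpace.single i 1) :=
    hφ.continuous_fderiv.clm_apply continuous_const
  have hd0 : ∀ x, x ∉ tsupport φ → fderiv ℝ φ x (EuclideanSpace.single i 1) = 0 := fun x hx => by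
    rw [image_eq_zero_of_notMem_tsupport fun h => hx (tsupport_fderiv_subset ℝ h)]; simp
  have h0 : ∀ x, x ∉ tsupport φ → φ x = 0 := fun x hx => image_eq_zero_of_notMem_tsupport hx
  simp only [PiLp.add_apply, add_mul]
  rw [integral_add (hprod hu.1 hd hd0) (hprod hw.1 hd hd0), hu.2.2 φ hφ i, hw.2.2 φ hφ i,
    integral_add (hprod (hcoord hu.2.1) hφ.1.continuous h0)
      (hprod (hcoord hw.2.1) hφ.1.continuous h0), neg_add]

variable {f : EuclideanSpace ℝ (Fin n) → EuclideanSpace ℝ (Fin n) → ℝ}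
  {ustar u : EuclideanSpace ℝ (Fin n) → ℝ}

/-- `weakGradient` is a chosen representative, so additivity comes from uniqueness and only almost
everywhere. -/
theorem weakGradient_eq_add_of_hasW011Gradient_sub (hΩ : IsOpen Ω) (hstar : MemW11 Ω ustar)
    {v : EuclideanSpace ℝ (Fin n) → ℝ}
    {G : EuclideanSpace ℝ (Fin n) → EuclideanSpace ℝ (Fin n)}
    (h : HasW011Gradient Ω v G) :
    weakGradient Ω (fun x => v x + ustar x) =ᵐ[volume.restrict Ω]
      fun x => G x + weakGradient Ω ustar x :=
  have h1 := h.hasWeakGradient.add hstar.2.1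
  h1.weakGradient.ae_eq hΩ h1

/-- Comparing a minimizer with its truncations. -/
theorem IsMinimizer.setIntegral_le (hΩ : IsOpen Ω) (hu : IsMinimizer Ω f ustar u)
    (hstar : MemW11 Ω ustar) (hf : IntegrableOn (fun x => f x (weakGradient Ω ustar x)) Ω)
    {k : ℝ} (hk : 0 ≤ k) :
    ∫ x in {x | k < |u x - ustar x|}, f x (weakGradient Ω u x) ∂(volume.restrict Ω) ≤
      ∫ x in {x | k < |u x - ustar x|}, f x (weakGradient Ω ustar x) ∂(volume.restrict Ω) := by
  obtain ⟨⟨hv, hfu⟩, hmin⟩ := hu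
  have hv' := HasW011Gradient.of_memW011 hv
  set A := {x | k < |u x - ustar x|} with hA
  have hAm : NullMeasurableSet A (volume.restrict Ω) :=
    nullMeasurableSet_lt_abs hv'.1.aestronglyMeasurable k
  have hT := hv'.truncation hk
  have hgu := weakGradient_eq_add_of_hasW011Gradient_sub hΩ hstar hv'
  have hgw := weakGradient_eq_add_of_hasW011Gradient_sub hΩ hstar hT
  simp only [sub_add_cancel] at hgu
  set w := fun x => max (-k) (min k (u x - ustar x)) + ustar x with hw
  -- On `A` the truncation is locked at `±k`, so `Dw = Du_*`; off `A` nothing changes and `Dw = Du`.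
  -- The energies over `Aᶜ` then cancel.
  have hfw : (fun x => f x (weakGradient Ω w x)) =ᵐ[volume.restrict Ω]
      fun x => A.indicator (fun x => f x (weakGradient Ω ustar x)) x +
        Aᶜ.indicator (fun x => f x (weakGradient Ω u x)) x := by
    filter_upwards [hgu, hgw] with x hx1 hx2
    rw [hx2]
    by_cases hx : x ∈ A
    · rw [indicator_of_mem hx, indicator_of_notMem (s := Aᶜ) (by simpa using hx),
        indicator_of_notMem, zero_smul, zero_add, add_zero]
      intro h
      exact (not_le.2 hx) (abs_le.2 h)
    · rw [indicator_of_notMem hx, indicator_of_mem (s := Aᶜ) (by simpa using hx),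
        indicator_of_mem, one_smul, zero_add, hx1]
      exact abs_le.1 (not_lt.1 hx)
  have hi1 := Integrable.indicator₀ hf hAm
  have hi2 := Integrable.indicator₀ hfu hAm.compl
  have hwc : w ∈ competitors Ω f ustar := by
    refine ⟨?_, (hi1.add hi2).congr hfw.symm⟩
    simp only [hw, add_sub_cancel_right]
    exact hT.memW011 hΩ
  have h1 := hmin w hwc
  rw [energy, energy, integral_congr_ae hfw, integral_add hi1 hi2, integral_indicator₀ hAm,
    integral_indicator₀ hAm.compl, ← integral_add_compl₀ hAm hfu] at h1
  linarith

end Energy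

/-! ### From energy to the gradient on level sets. -/

section LevelSetEnergy

variable {n : ℕ} {Ω : Set (EuclideanSpace ℝ (Fin n))}
  {f : EuclideanSpace ℝ (Fin n) → EuclideanSpace ℝ (Fin n) → ℝ}
  {a ustar u : EuclideanSpace ℝ (Fin n) → ℝ} {g : ℝ → ℝ} {p μ ν : ℝ}

/-- The gradient of `u - u_*` on a level set is controlled by the energy of `u_*` there. -/
theorem IsMinimizer.setIntegral_norm_weakGradient_le (hΩ : IsOpen Ω) (hfin : volume Ω ≠ ⊤)
    (hu : IsMinimizer Ω f ustar u) (hstar : MemW11 Ω ustar)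
    (hf : IntegrableOn (fun x => f x (weakGradient Ω ustar x)) Ω) (ha : IntegrableOn a Ω)
    (hg : IsGrowthFunction g μ) (hp : 1 ≤ p) (hν : 0 < ν)
    (hbd : ∀ᵐ x ∂(volume.restrict Ω), ∀ z, ν * g ‖z‖ ^ p - a x ≤ f x z)
    {k s : ℝ} (hk : 0 ≤ k) (hs : 0 < s) :
    ∫ x in {x | k < |u x - ustar x|}, ‖weakGradient Ω (fun x => u x - ustar x) x‖
        ∂(volume.restrict Ω) ≤
      2 * s * ((volume.restrict Ω).real {x | k < |u x - ustar x|} +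
        (∫ x in {x | k < |u x - ustar x|}, (f x (weakGradient Ω ustar x) + a x)
          ∂(volume.restrict Ω)) / (ν * g s ^ p)) := by
  have := Fact.mk hfin.lt_top
  have hv := HasW011Gradient.of_memW011 hu.1.1
  have hgu := weakGradient_eq_add_of_hasW011Gradient_sub hΩ hstar hv
  simp only [sub_add_cancel] at hgu
  have hmin := hu.setIntegral_le hΩ hstar hf hk
  set A := {x | k < |u x - ustar x|} with hA
  have hfu := hu.1.2
  have hgs : 0 < g s ^ p := Real.rpow_pos_of_pos (hg.pos s hs) p
  set c := s / (ν * g s ^ p) with hc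
  have hc0 : 0 ≤ c := by positivity
  have hpt : ∀ᵐ x ∂(volume.restrict Ω), ‖weakGradient Ω (fun x => u x - ustar x) x‖ ≤
      2 * s + c * ((f x (weakGradient Ω u x) + a x) + (f x (weakGradient Ω ustar x) + a x)) := by
    filter_upwards [hgu, hbd] with x hx hb
    -- Used for both `Du` and `Du_*`, which produces the term `2 * s`; minimality then replaces the
    -- energy of `u` by a second copy of that of `u_*`.
    have hz : ∀ z, ‖z‖ ≤ s + c * (f x z + a x) := by
      intro z
      refine (hg.le_add_mul_rpow_div hp hs (norm_nonneg z)).trans ?_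
      have h1 : g ‖z‖ ^ p ≤ (f x z + a x) / ν := by
        rw [le_div_iff₀ hν]
        linarith [hb z]
      have h2 : s * (g ‖z‖ ^ p / g s ^ p) ≤ s * ((f x z + a x) / ν / g s ^ p) := by gcongr
      refine (add_le_add_right h2 s).trans (le_of_eq ?_)
      rw [hc]
      field_simp
    have h3 : weakGradient Ω (fun x => u x - ustar x) x =
        weakGradient Ω u x - weakGradient Ω ustar x := by rw [hx, add_sub_cancel_right]
    rw [h3]
    linarith [norm_sub_le (weakGradient Ω u x) (weakGradient Ω ustar x),
      hz (weakGradient Ω u x), hz (weakGradient Ω ustar x)]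
  have hi1 : IntegrableOn (fun x => f x (weakGradient Ω u x)) A (volume.restrict Ω) :=
    hfu.integrableOn
  have hi2 : IntegrableOn (fun x => f x (weakGradient Ω ustar x)) A (volume.restrict Ω) :=
    Integrable.integrableOn hf
  have hia : IntegrableOn a A (volume.restrict Ω) := Integrable.integrableOn ha
  have hj1 : IntegrableOn (fun x => f x (weakGradient Ω u x) + a x) A (volume.restrict Ω) :=
    hi1.add hia
  have hj2 : IntegrableOn (fun x => f x (weakGradient Ω ustar x) + a x) A (volume.restrict Ω) :=
    hi2.add hia
  have hi3 : IntegrableOn (fun x => (f x (weakGradient Ω u x) + a x) +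
      (f x (weakGradient Ω ustar x) + a x)) A (volume.restrict Ω) := hj1.add hj2
  have h1 := setIntegral_mono_ae (s := A) (Integrable.integrableOn hv.2.1.norm)
    ((integrable_const (2 * s)).add (hi3.const_mul c)) hpt
  refine h1.trans ?_
  simp only [Pi.add_apply]
  rw [integral_add (integrable_const _) (hi3.const_mul c), integral_const, integral_const_mul,
    integral_add hj1 hj2, integral_add hi1 hia, integral_add hi2 hia,
    measureReal_restrict_apply_univ, smul_eq_mul]
  have h2 : c * (((∫ x in A, f x (weakGradient Ω u x) ∂(volume.restrict Ω)) +
      ∫ x in A, a x ∂(volume.restrict Ω)) +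
      ((∫ x in A, f x (weakGradient Ω ustar x) ∂(volume.restrict Ω)) +
      ∫ x in A, a x ∂(volume.restrict Ω))) ≤
      c * (2 * ((∫ x in A, f x (weakGradient Ω ustar x) ∂(volume.restrict Ω)) +
      ∫ x in A, a x ∂(volume.restrict Ω))) := by
    refine mul_le_mul_of_nonneg_left ?_ hc0
    linarith
  refine (add_le_add_right h2 _).trans (le_of_eq ?_)
  rw [hc]
  ring

/-- Hölder's inequality, keeping the norm over `A` itself: its smallness on high level sets decides
the borderline case. -/
theorem setIntegral_le_eLpNorm_mul_measureReal_rpow {α : Type*} {m : MeasurableSpace α}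
    {m0 : Measure α} [IsFiniteMeasure m0] {F : α → ℝ} {σ : ℝ} (hσ : 1 ≤ σ)
    (hF : MemLp F (ENNReal.ofReal σ) m0) (A : Set α) :
    ∫ x in A, F x ∂m0 ≤
      (eLpNorm F (ENNReal.ofReal σ) (m0.restrict A)).toReal * m0.real A ^ (1 - 1 / σ) := by
  have h1 := eLpNorm_le_eLpNorm_mul_rpow_measure_univ (p := 1) (q := ENNReal.ofReal σ)
    (by simpa using hσ) hF.1.restrict (μ := m0.restrict A)
  have hfin := (hF.mono_measure (Measure.restrict_le_self (s := A))).2.ne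
  rw [ENNReal.toReal_ofReal (by linarith), ENNReal.toReal_one, div_one,
    Measure.restrict_apply_univ] at h1
  have hexp : 0 ≤ 1 - 1 / σ := by
    rw [sub_nonneg, div_le_one (by linarith)]; exact hσ
  have h2 := ENNReal.toReal_mono (ENNReal.mul_ne_top hfin
    (ENNReal.rpow_ne_top_of_nonneg hexp (measure_ne_top m0 A))) h1
  rw [ENNReal.toReal_mul, ← ENNReal.toReal_rpow, eLpNorm_one_eq_lintegral_enorm,
    ← integral_norm_eq_lintegral_enorm hF.1.restrict] at h2
  exact ((le_abs_self _).trans (norm_integral_le_integral_norm F)).trans h2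

end LevelSetEnergy

/-! ### Abstract iteration lemmas. -/

section Iteration

/-- Stampacchia's lemma in the superlinear case. -/
theorem exists_eq_zero_of_superlinear_decay {Φ : ℝ → ℝ} (hΦ0 : ∀ k, 0 ≤ Φ k)
    (hΦ : Antitone Φ) {α γ C : ℝ} (hα : 0 < α) (hαγ : α < γ) (hC : 0 < C)
    (h : ∀ k h, 0 ≤ k → k < h → (h - k) * Φ h ^ α ≤ C * Φ k ^ γ) : ∃ d, 0 ≤ d ∧ Φ d = 0 := by
  set B := Φ 0 + 1 with hB
  have hB0 : 0 < B := by linarith [hΦ0 0]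
  have hδ : 0 < γ - α := sub_pos.2 hαγ
  -- Decay by `r` at each step gains `r^{γ-α} = 1/2`, which pays for the halved gap between
  -- consecutive levels; `d` is the total height for which the constants match.
  set r : ℝ := (1 / 2) ^ (1 / (γ - α)) with hr
  have hr0 : 0 < r := by positivity
  have hr1 : r < 1 := Real.rpow_lt_one (by norm_num) (by norm_num) (by positivity)
  have hrδ : r ^ (γ - α) = 1 / 2 := by
    rw [hr, ← Real.rpow_mul (by norm_num), one_div_mul_cancel hδ.ne', Real.rpow_one]
  set d := 2 * C * B ^ (γ - α) / r ^ α with hd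
  have hd0 : 0 < d := by positivity
  have hdr : d * r ^ α = 2 * C * B ^ (γ - α) := by
    rw [hd, div_mul_cancel₀]; positivity
  set κ : ℕ → ℝ := fun j => d * (1 - (1 / 2) ^ j) with hκ
  have hκd : ∀ j, κ (j + 1) - κ j = d * (1 / 2) ^ (j + 1) := by
    intro j; simp only [hκ, pow_succ]; ring
  have hstep : ∀ j, Φ (κ j) ≤ B * r ^ j := by
    intro j
    induction j with
    | zero => simp [hκ, hB]
    | succ j ih =>
      have hj0 : 0 ≤ κ j := mul_nonneg hd0.le
        (sub_nonneg.2 (pow_le_one₀ (by norm_num) (by norm_num)))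
      have hlt : κ j < κ (j + 1) := by
        rw [← sub_pos, hκd]; positivity
      have h1 := h _ _ hj0 hlt
      rw [hκd] at h1
      have h2 : Φ (κ j) ^ γ ≤ (B * r ^ j) ^ γ := Real.rpow_le_rpow (hΦ0 _) ih (by linarith)
      have h3 : (B * r ^ j) ^ γ = (B * r ^ j) ^ α * (B ^ (γ - α) * (1 / 2) ^ j) := by
        rw [← hrδ, ← Real.rpow_natCast (r ^ (γ - α)), ← Real.rpow_mul hr0.le, mul_comm (γ - α),
          Real.rpow_mul hr0.le, ← Real.mul_rpow hB0.le (by positivity), Real.rpow_natCast,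
          ← Real.rpow_add (by positivity)]
        congr 1; ring
      have h4 : (B * r ^ (j + 1)) ^ α = (B * r ^ j) ^ α * r ^ α := by
        rw [pow_succ, ← mul_assoc, Real.mul_rpow (by positivity) hr0.le]
      have h5 : Φ (κ (j + 1)) ^ α ≤ (B * r ^ (j + 1)) ^ α := by
        have hpos : 0 < d * (1 / 2) ^ (j + 1) := by positivity
        refine le_of_mul_le_mul_left ((h1.trans (mul_le_mul_of_nonneg_left h2 hC.le)).trans
          (le_of_eq ?_)) hpos
        rw [h3, h4]
        calc C * ((B * r ^ j) ^ α * (B ^ (γ - α) * (1 / 2) ^ j))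
            = (2 * C * B ^ (γ - α)) * (1 / 2) ^ (j + 1) * (B * r ^ j) ^ α := by
              rw [pow_succ]; ring
          _ = _ := by rw [← hdr]; ring
      exact (Real.rpow_le_rpow_iff (hΦ0 _) (by positivity) hα).1 h5
  refine ⟨d, hd0.le, le_antisymm ?_ (hΦ0 d)⟩
  have hlim : Tendsto (fun j : ℕ => B * r ^ j) atTop (𝓝 (B * 0)) :=
    (tendsto_pow_atTop_nhds_zero_of_lt_one hr0.le hr1).const_mul B
  rw [mul_zero] at hlim
  refine ge_of_tendsto' hlim fun j => (hΦ ?_).trans (hstep j)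
  have : 0 ≤ d * (1 / 2) ^ j := by positivity
  simp only [hκ]; linarith

theorem le_rpow_of_le_mul_rpow {α γ x y c : ℝ} (hα : 0 < α) (hx : 0 ≤ x) (hy : 0 ≤ y)
    (hc : 0 ≤ c) (h : y ^ α ≤ c * x ^ γ) : y ≤ c ^ (1 / α) * x ^ (γ / α) := by
  have h1 := Real.rpow_le_rpow (Real.rpow_nonneg hy α) h (z := 1 / α) (by positivity)
  rwa [← Real.rpow_mul hy, mul_one_div_cancel hα.ne', Real.rpow_one,
    Real.mul_rpow hc (Real.rpow_nonneg hx γ), ← Real.rpow_mul hx, mul_one_div] at h1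

/-- A function that, at twice the argument, is bounded by a sublinear power of its value or by its
value is bounded. -/
theorem exists_bound_of_sublinear_doubling {ψ : ℝ → ℝ} {k₀ B C β : ℝ} (hk₀ : 0 < k₀) (hβ0 : 0 ≤ β)
    (hβ : β < 1) (hC : 0 ≤ C) (hψ0 : ∀ k, 0 < k → 0 ≤ ψ k)
    (hB : ∀ k, 0 < k → k ≤ 2 * k₀ → ψ k ≤ B)
    (h : ∀ k, k₀ ≤ k → ψ (2 * k) ≤ max (C * ψ k ^ β) (ψ k)) :
    ∃ γ, ∀ k, 0 < k → ψ k ≤ γ := by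
  -- `K ≥ C^{1/(1-β)}` amounts to `C K^β ≤ K`, so the bound `K` survives each doubling; the `1` only
  -- secures positivity.
  set K := max (max B 1) (C ^ (1 / (1 - β))) with hK
  have hK1 : 1 ≤ K := (le_max_right _ _).trans (le_max_left _ _)
  have hK0 : 0 < K := by linarith
  have hδ : 0 < 1 - β := sub_pos.2 hβ
  have hCK : C * K ^ β ≤ K := by
    have h1 : C ≤ K ^ (1 - β) := by
      calc C = (C ^ (1 / (1 - β))) ^ (1 - β) := by
            rw [← Real.rpow_mul hC, one_div_mul_cancel hδ.ne', Real.rpow_one]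
        _ ≤ K ^ (1 - β) := Real.rpow_le_rpow (by positivity) (le_max_right _ _) hδ.le
    calc C * K ^ β ≤ K ^ (1 - β) * K ^ β := by gcongr
      _ = K := by rw [← Real.rpow_add hK0]; simp
  have hmain : ∀ j : ℕ, ∀ k, 0 < k → k ≤ 2 ^ j * (2 * k₀) → ψ k ≤ K := by
    intro j
    induction j with
    | zero =>
      intro k hk hk2
      exact (hB k hk (by simpa using hk2)).trans ((le_max_left _ _).trans (le_max_left _ _))
    | succ j ih =>
      intro k hk hk2
      rcases le_total k (2 * k₀) with hle | hle
      · exact (hB k hk hle).trans ((le_max_left _ _).trans (le_max_left _ _))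
      · have hk3 : ψ (k / 2) ≤ K := ih (k / 2) (by linarith) (by rw [pow_succ] at hk2; linarith)
        have h1 := h (k / 2) (by linarith)
        rw [mul_div_cancel₀ k two_ne_zero] at h1
        refine h1.trans (max_le ?_ hk3)
        refine le_trans ?_ hCK
        have := Real.rpow_le_rpow (hψ0 (k / 2) (by linarith)) hk3 hβ0
        gcongr
  refine ⟨K, fun k hk => ?_⟩
  obtain ⟨j, hj⟩ := pow_unbounded_of_one_lt (k / (2 * k₀)) (one_lt_two)
  rw [div_lt_iff₀ (by linarith)] at hj
  exact hmain j k hk hj.le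

end Iteration

/-! ### Decay of the distribution function in the three regimes. -/

section Decay

variable {g Φ N : ℝ → ℝ} {μ p ν σ α S : ℝ}

/-- The level set inequality, with the parameter scaled like a power of the distribution
function. -/
theorem mul_rpow_le_of_level_set_inequality (hp : 0 < p) (hν : 0 < ν)
    (hσ : 0 < σ) (hα : 0 < α) (hS : 0 < S) (hΦ0 : ∀ k, 0 ≤ Φ k) (hΦ : Antitone Φ)
    (hN0 : ∀ k, 0 ≤ N k) {c : ℝ} (hc : 0 < c) (hcg : ∀ t, 0 ≤ t → c * t ≤ g t)
    (key : ∀ k h s, 0 ≤ k → k < h → 0 < s →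
      (h - k) * Φ h ^ α ≤ 2 * S * s * (Φ k + N k * Φ k ^ (1 - 1 / σ) / (ν * g s ^ p)))
    {δ k h : ℝ} (hδ : 0 < δ) (hk : 0 ≤ k) (hkh : k < h) :
    (h - k) * Φ h ^ α ≤
      2 * S * δ * (1 + N k / (ν * (c * δ) ^ p)) * Φ k ^ (1 - 1 / (σ * p)) := by
  rcases (hΦ0 k).eq_or_lt with h0 | hx
  · have : Φ h = 0 := le_antisymm ((hΦ hkh.le).trans h0.ge) (hΦ0 h)
    have hNk := hN0 k
    rw [this, Real.zero_rpow hα.ne', mul_zero]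
    have := Real.rpow_nonneg (hΦ0 k) (1 - 1 / (σ * p))
    positivity
  · set x := Φ k with hxdef
    -- With this power, `g s ≥ c s` makes the second term in `key` a multiple of `x`, like the
    -- first.
    set s := δ * x ^ (-(1 / (σ * p))) with hs
    have hs0 : 0 < s := by positivity
    refine (key k h s hk hkh hs0).trans ?_
    have hgs : (c * δ) ^ p * x ^ (-(1 / σ)) ≤ g s ^ p := by
      have h1 : x ^ (-(1 / σ)) = (x ^ (-(1 / (σ * p)))) ^ p := by
        rw [← Real.rpow_mul hx.le]; congr 1; field_simp
      rw [h1, ← Real.mul_rpow (by positivity) (by positivity)]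
      refine Real.rpow_le_rpow (by positivity) ?_ hp.le
      rw [mul_assoc]
      exact hcg s hs0.le
    have h2 : N k * x ^ (1 - 1 / σ) / (ν * g s ^ p) ≤ N k / (ν * (c * δ) ^ p) * x := by
      have hNk := hN0 k
      calc N k * x ^ (1 - 1 / σ) / (ν * g s ^ p)
          ≤ N k * x ^ (1 - 1 / σ) / (ν * ((c * δ) ^ p * x ^ (-(1 / σ)))) := by gcongr
        _ = N k / (ν * (c * δ) ^ p) * x := by
          rw [sub_eq_add_neg, Real.rpow_add hx, Real.rpow_one]
          field_simp
    have h3 : s * x = δ * x ^ (1 - 1 / (σ * p)) := by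
      rw [hs, sub_eq_add_neg, Real.rpow_add hx, Real.rpow_one]; ring
    calc 2 * S * s * (x + N k * x ^ (1 - 1 / σ) / (ν * g s ^ p))
        ≤ 2 * S * s * (x + N k / (ν * (c * δ) ^ p) * x) := by gcongr
      _ = 2 * S * (s * x) * (1 + N k / (ν * (c * δ) ^ p)) := by ring
      _ = _ := by rw [h3]; ring

/-- Decay of the distribution function faster than any geometric sequence. -/
theorem eventually_le_mul_of_level_set_inequality (hp : 0 < p) (hν : 0 < ν)
    (hσ : 0 < σ) (hα : 0 < α) (hS : 0 < S) (hΦ0 : ∀ k, 0 ≤ Φ k) (hΦ : Antitone Φ)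
    (hN0 : ∀ k, 0 ≤ N k) (hN : Tendsto N atTop (𝓝 0)) {c : ℝ} (hc : 0 < c)
    (hcg : ∀ t, 0 ≤ t → c * t ≤ g t)
    (key : ∀ k h s, 0 ≤ k → k < h → 0 < s →
      (h - k) * Φ h ^ α ≤ 2 * S * s * (Φ k + N k * Φ k ^ (1 - 1 / σ) / (ν * g s ^ p)))
    (hασ : 1 - 1 / (σ * p) = α) {q : ℝ} (hq : 0 < q) :
    ∀ᶠ k in atTop, Φ (k + 1) ≤ q * Φ k := by
  -- Once `N k ≤ ν (c δ)^p` the constant is at most `4 S δ = q^α`.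
  set δ := q ^ α / (4 * S) with hδ
  have hδ0 : 0 < δ := by positivity
  have hpos : 0 < ν * (c * δ) ^ p := by positivity
  filter_upwards [hN.eventually_le_const hpos, eventually_ge_atTop 0] with k hk hk0
  have h1 := mul_rpow_le_of_level_set_inequality hp hν hσ hα hS hΦ0 hΦ hN0 hc hcg key hδ0
    hk0 (lt_add_one k)
  rw [add_sub_cancel_left, one_mul, hασ] at h1
  have h2 : N k / (ν * (c * δ) ^ p) ≤ 1 := (div_le_one hpos).2 hk
  have hx := Real.rpow_nonneg (hΦ0 k) α
  have h3 : Φ (k + 1) ^ α ≤ (q * Φ k) ^ α := by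
    rw [Real.mul_rpow hq.le (hΦ0 k)]
    calc Φ (k + 1) ^ α ≤ 2 * S * δ * (1 + N k / (ν * (c * δ) ^ p)) * Φ k ^ α := h1
      _ ≤ 2 * S * δ * (1 + 1) * Φ k ^ α := by gcongr
      _ = q ^ α * Φ k ^ α := by rw [hδ]; field_simp; norm_num
  exact (Real.rpow_le_rpow_iff (hΦ0 _) (mul_nonneg hq.le (hΦ0 k)) hα).1 h3

/-- Either the distribution function drops superlinearly, or it satisfies the inequality that
yields the decay of `g`. -/
theorem rpow_le_or_mul_rpow_le_of_level_set_inequality (hg : IsGrowthFunction g μ) (hp : 0 < p)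
    (hν : 0 < ν) (hσ : 0 < σ) (hα : 0 < α) (hS : 0 < S) (hΦ0 : ∀ k, 0 ≤ Φ k) (hΦ : Antitone Φ)
    {N₀ : ℝ} (hN₀ : 0 < N₀) (hN : ∀ k, 0 ≤ k → N k ≤ N₀)
    (key : ∀ k h s, 0 ≤ k → k < h → 0 < s →
      (h - k) * Φ h ^ α ≤ 2 * S * s * (Φ k + N k * Φ k ^ (1 - 1 / σ) / (ν * g s ^ p)))
    {k : ℝ} (hk : 0 < k) :
    Φ (2 * k) ^ α ≤ 4 * S * Φ k ∨
      Φ (2 * k) ^ α ≤ 4 * S * (N₀ / ν) ^ (1 / p) / g k * Φ k ^ (1 - 1 / (σ * p)) := by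
  rcases (hΦ0 k).eq_or_lt with h0 | hx
  · have : Φ (2 * k) = 0 := le_antisymm ((hΦ (by linarith)).trans h0.ge) (hΦ0 _)
    left
    rw [this, Real.zero_rpow hα.ne']
    positivity
  · set x := Φ k with hxdef
    set y := Φ (2 * k) with hydef
    have hgk := hg.pos k hk
    -- This value of `g s` gives `ν g(s)^p = N₀ x^{-1/σ}`, so the second term in `key` is at most
    -- `x`.
    obtain ⟨s, hs0, hs⟩ := hg.exists_eq
      (show 0 < (N₀ / ν) ^ (1 / p) * x ^ (-(1 / (σ * p))) by positivity)
    have h1 := key k (2 * k) s hk.le (by linarith) hs0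
    have h2 : ν * g s ^ p = N₀ * x ^ (-(1 / σ)) := by
      rw [hs, Real.mul_rpow (by positivity) (by positivity), ← Real.rpow_mul (by positivity),
        ← Real.rpow_mul hx.le, one_div_mul_cancel hp.ne', Real.rpow_one]
      have : -(1 / (σ * p)) * p = -(1 / σ) := by field_simp
      rw [this]
      field_simp
    have h3 : N k * x ^ (1 - 1 / σ) / (ν * g s ^ p) ≤ x := by
      rw [h2]
      have hNk := hN k hk.le
      calc N k * x ^ (1 - 1 / σ) / (N₀ * x ^ (-(1 / σ)))
          ≤ N₀ * x ^ (1 - 1 / σ) / (N₀ * x ^ (-(1 / σ))) := by gcongr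
        _ = x := by
          rw [sub_eq_add_neg, Real.rpow_add hx, Real.rpow_one]
          field_simp
    have h4 : k * y ^ α ≤ 4 * S * s * x := by
      calc k * y ^ α = (2 * k - k) * y ^ α := by ring
        _ ≤ 2 * S * s * (x + N k * x ^ (1 - 1 / σ) / (ν * g s ^ p)) := h1
        _ ≤ 2 * S * s * (x + x) := by gcongr
        _ = 4 * S * s * x := by ring
    -- If `s ≤ k`, the factor `s` is absorbed by `k`; otherwise monotonicity of `g(t)/t` gives `s /
    -- k ≤ g s / g k`, and `g s` is known.
    rcases le_total s k with hsk | hsk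
    · left
      refine le_of_mul_le_mul_left (h4.trans ?_) hk
      calc 4 * S * s * x ≤ 4 * S * k * x := by gcongr
        _ = _ := by ring
    · right
      have h5 := hg.mul_le_mul_of_le hk.le hsk
      rw [div_mul_eq_mul_div, le_div_iff₀ hgk]
      refine le_of_mul_le_mul_left ?_ hk
      calc k * (y ^ α * g k) = k * y ^ α * g k := by ring
        _ ≤ 4 * S * s * x * g k := by gcongr
        _ = 4 * S * x * (s * g k) := by ring
        _ ≤ 4 * S * x * (k * g s) := by gcongr
        _ = k * (4 * S * (N₀ / ν) ^ (1 / p) * (x * x ^ (-(1 / (σ * p))))) := by rw [hs]; ring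
        _ = _ := by
          rw [sub_eq_add_neg, Real.rpow_add hx, Real.rpow_one]

/-- Power decay of the distribution function in terms of `g`. -/
theorem exists_mul_rpow_le_of_level_set_inequality (hg : IsGrowthFunction g μ) (hp : 0 < p)
    (hν : 0 < ν) (hσ : 0 < σ) (hα : 0 < α) (hα1 : α < 1) (hS : 0 < S) (hΦ0 : ∀ k, 0 ≤ Φ k)
    (hΦ : Antitone Φ) (hΦlim : Tendsto Φ atTop (𝓝 0))
    {N₀ : ℝ} (hN₀ : 0 < N₀) (hN : ∀ k, 0 ≤ k → N k ≤ N₀)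
    (key : ∀ k h s, 0 ≤ k → k < h → 0 < s →
      (h - k) * Φ h ^ α ≤ 2 * S * s * (Φ k + N k * Φ k ^ (1 - 1 / σ) / (ν * g s ^ p)))
    {m : ℝ} (hm : 0 < m) (hσp : 0 ≤ 1 - 1 / (σ * p)) (hmα : m * (α - (1 - 1 / (σ * p))) = 1) :
    ∃ γ, ∀ k, 0 < k → Φ k * g k ^ m ≤ γ := by
  set e := 1 - 1 / (σ * p) with he
  have heα : e < α := by
    by_contra! hcon
    nlinarith
  -- Beyond `k₀` the superlinear drop of `Φ` beats the growth factor `2^{μm}` of `g^m`, so that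
  -- alternative does not increase `Φ g^m`.
  have hlim : Tendsto (fun k => 2 ^ (μ * m) * (4 * S) ^ (1 / α) * Φ k ^ (1 / α - 1)) atTop
      (𝓝 0) := by
    have hexp : 0 < 1 / α - 1 := by
      rw [sub_pos, one_lt_div hα]; exact hα1
    have := (hΦlim.rpow_const (p := 1 / α - 1) (Or.inr hexp.le)).const_mul
      (2 ^ (μ * m) * (4 * S) ^ (1 / α))
    rwa [Real.zero_rpow hexp.ne', mul_zero] at this
  obtain ⟨k₀, hk₀, hk₀0⟩ := ((eventually_forall_ge_atTop.2
    (hlim.eventually_le_const one_pos)).and (eventually_gt_atTop 0)).exists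
  set D := 4 * S * (N₀ / ν) ^ (1 / p) with hD
  have hD0 : 0 < D := by positivity
  refine exists_bound_of_sublinear_doubling (ψ := fun k => Φ k * g k ^ m) (k₀ := k₀)
    (B := Φ 0 * g (2 * k₀) ^ m) (C := 2 ^ (μ * m) * D ^ (1 / α)) (β := e / α) hk₀0
    (by positivity) ((div_lt_one hα).2 heα) (by positivity)
    (fun k hk => mul_nonneg (hΦ0 k) (Real.rpow_nonneg (hg.nonneg hk.le) m)) ?_ ?_
  · intro k hk hk2
    have hgk := hg.pos k hk
    have h1 : g k ≤ g (2 * k₀) := hg.monotoneOn hk.le (hk.le.trans hk2) hk2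
    have h2 := hΦ hk.le
    have h3 := hΦ0 0
    gcongr
  · intro k hk
    have hk0 : 0 < k := hk₀0.trans_le hk
    have hgk := hg.pos k hk0
    have hx := hΦ0 k
    have hg2 : g (2 * k) ^ m ≤ 2 ^ (μ * m) * g k ^ m := by
      rw [Real.rpow_mul two_pos.le, ← Real.mul_rpow (by positivity) hgk.le]
      exact Real.rpow_le_rpow (hg.nonneg (by linarith)) (hg.map_mul_le 2 one_lt_two k hk0) hm.le
    have hstep : Φ (2 * k) * g (2 * k) ^ m ≤ Φ (2 * k) * (2 ^ (μ * m) * g k ^ m) :=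
      mul_le_mul_of_nonneg_left hg2 (hΦ0 _)
    rcases rpow_le_or_mul_rpow_le_of_level_set_inequality hg hp hν hσ hα hS hΦ0 hΦ hN₀ hN key hk0
      with h | h
    · refine le_max_of_le_right (hstep.trans ?_)
      have h1 := le_rpow_of_le_mul_rpow (γ := 1) (c := 4 * S) hα hx (hΦ0 (2 * k))
        (by positivity) (by rwa [Real.rpow_one])
      have h2 : Φ k ^ (1 / α) = Φ k ^ (1 / α - 1) * Φ k := by
        rcases hx.eq_or_lt with h0 | h0
        · rw [← h0, mul_zero, Real.zero_rpow (by positivity)]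
        · rw [← Real.rpow_add_one h0.ne']; congr 1; ring
      calc Φ (2 * k) * (2 ^ (μ * m) * g k ^ m)
          ≤ (4 * S) ^ (1 / α) * Φ k ^ (1 / α) * (2 ^ (μ * m) * g k ^ m) := by gcongr
        _ = (2 ^ (μ * m) * (4 * S) ^ (1 / α) * Φ k ^ (1 / α - 1)) * (Φ k * g k ^ m) := by
          rw [h2]; ring
        _ ≤ 1 * (Φ k * g k ^ m) := by
          gcongr
          exact hk₀ k hk
        _ = _ := one_mul _
    · refine le_max_of_le_left (hstep.trans ?_)
      have h1 := le_rpow_of_le_mul_rpow hα hx (hΦ0 (2 * k)) (by positivity) h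
      -- The exponents of `g k` match because `m (α - e) = 1`, that is `m - 1/α = m e / α`; this
      -- determines `m`.
      have h2 : (Φ k * g k ^ m) ^ (e / α) = Φ k ^ (e / α) * (g k ^ m / g k ^ (1 / α)) := by
        rw [Real.mul_rpow hx (by positivity), ← Real.rpow_mul hgk.le, ← Real.rpow_sub hgk]
        congr 2
        field_simp
        linarith
      rw [Real.div_rpow hD0.le hgk.le] at h1
      calc Φ (2 * k) * (2 ^ (μ * m) * g k ^ m)
          ≤ D ^ (1 / α) / g k ^ (1 / α) * Φ k ^ (e / α) * (2 ^ (μ * m) * g k ^ m) := by gcongr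
        _ = 2 ^ (μ * m) * D ^ (1 / α) * (Φ k ^ (e / α) * (g k ^ m / g k ^ (1 / α))) := by ring
        _ = _ := by rw [← h2]

end Decay

/-! ### From the distribution function back to integrability. -/

section Distribution

variable {α : Type*} {m : MeasurableSpace α} {m0 : Measure α} [IsFiniteMeasure m0] {v : α → ℝ}

theorem tendsto_measure_lt_abs_atTop (hv : AEStronglyMeasurable v m0) :
    Tendsto (fun k : ℝ => m0 {x | k < |v x|}) atTop (𝓝 0) := by
  have h := tendsto_measure_iInter_atTop (μ := m0) (s := fun k : ℝ => {x | k < |v x|})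
    (fun k => nullMeasurableSet_lt_abs hv k) (fun k l hkl x hx => lt_of_le_of_lt hkl hx)
    ⟨0, measure_ne_top _ _⟩
  have hempty : ⋂ k : ℝ, {x | k < |v x|} = ∅ :=
    eq_empty_of_forall_notMem fun x hx => lt_irrefl |v x| (mem_iInter.1 hx |v x|)
  rwa [hempty, measure_empty] at h

/-- Absolute continuity of the integral of `|F|^σ`, as the level sets shrink to a null set. -/
theorem tendsto_eLpNorm_restrict_lt_abs_atTop (hv : AEStronglyMeasurable v m0) {F : α → ℝ} {σ : ℝ}
    (hσ : 0 < σ) (hF : MemLp F (ENNReal.ofReal σ) m0) :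
    Tendsto (fun k : ℝ => (eLpNorm F (ENNReal.ofReal σ) (m0.restrict {x | k < |v x|})).toReal)
      atTop (𝓝 0) := by
  have hσ0 : ENNReal.ofReal σ ≠ 0 := by simpa using hσ
  have h1 := tendsto_setLIntegral_zero
    (lintegral_rpow_enorm_lt_top_of_eLpNorm_lt_top hσ0 ENNReal.ofReal_ne_top hF.2).ne
    (tendsto_measure_lt_abs_atTop hv)
  have h2 := h1.ennrpow_const (1 / (ENNReal.ofReal σ).toReal)
  rw [ENNReal.zero_rpow_of_pos (by rw [ENNReal.toReal_ofReal hσ.le]; positivity)] at h2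
  have h3 := (ENNReal.tendsto_toReal ENNReal.zero_ne_top).comp h2
  rw [ENNReal.toReal_zero] at h3
  refine h3.congr fun k => ?_
  rw [eLpNorm_eq_lintegral_rpow_enorm_toReal hσ0 ENNReal.ofReal_ne_top]
  rfl

theorem integrable_exp_abs_of_eventually_le (hv : AEStronglyMeasurable v m0)
    (h : ∀ᶠ k : ℝ in atTop,
      m0.real {x | k + 1 < |v x|} ≤ Real.exp (-2) * m0.real {x | k < |v x|}) :
    Integrable (fun x => Real.exp |v x|) m0 := by
  -- The decay factor `e^{-2}` outweighs the growth factor `e` of the weights, leaving ratio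
  -- `e^{-1}`.
  have hsum : Summable fun j : ℕ => Real.exp (j + 1) * m0.real {x | (j : ℝ) < |v x|} := by
    refine summable_of_ratio_norm_eventually_le (r := Real.exp (-1))
      (Real.exp_lt_one_iff.2 (by norm_num)) ?_
    filter_upwards [tendsto_natCast_atTop_atTop.eventually h] with j hj
    rw [Real.norm_of_nonneg (by positivity), Real.norm_of_nonneg (by positivity), Nat.cast_add,
      Nat.cast_one]
    calc Real.exp (j + 1 + 1) * m0.real {x | (j : ℝ) + 1 < |v x|}
        ≤ Real.exp (j + 1 + 1) * (Real.exp (-2) * m0.real {x | (j : ℝ) < |v x|}) := by gcongr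
      _ = (Real.exp (j + 1 + 1) * Real.exp (-2)) * m0.real {x | (j : ℝ) < |v x|} := by ring
      _ = (Real.exp (-1) * Real.exp (j + 1)) * m0.real {x | (j : ℝ) < |v x|} := by
        rw [← Real.exp_add, ← Real.exp_add]; ring_nf
      _ = _ := by ring
  refine ⟨Real.continuous_exp.comp_aestronglyMeasurable hv.norm, ?_⟩
  rw [HasFiniteIntegral]
  -- The single term `j = ⌈|v x|⌉ - 1` suffices; the summand `1` covers `v x = 0`, where every
  -- indicator vanishes.
  have hpt : ∀ x, ‖Real.exp |v x|‖ₑ ≤ 1 + ∑' j : ℕ,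
      {x | (j : ℝ) < |v x|}.indicator (fun _ => ENNReal.ofReal (Real.exp (j + 1))) x := by
    intro x
    rw [Real.enorm_eq_ofReal (Real.exp_pos _).le]
    rcases (abs_nonneg (v x)).eq_or_lt with h0 | h0
    · rw [← h0]; simp
    · obtain ⟨j, hj⟩ := Nat.exists_eq_succ_of_ne_zero (Nat.ceil_pos.2 h0).ne'
      have hj1 : |v x| ≤ j + 1 := by
        have := Nat.le_ceil |v x|
        rw [hj] at this
        exact_mod_cast this
      have hj2 : (j : ℝ) < |v x| := Nat.lt_ceil.1 (by omega)
      refine le_trans ?_ (le_add_left (ENNReal.le_tsum j))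
      rw [indicator_of_mem (by exact hj2)]
      exact ENNReal.ofReal_le_ofReal (Real.exp_le_exp.2 hj1)
  refine (lintegral_mono hpt).trans_lt ?_
  rw [lintegral_add_left measurable_const, lintegral_tsum fun j =>
    aemeasurable_const.indicator₀ (nullMeasurableSet_lt_abs hv _)]
  refine ENNReal.add_lt_top.2 ⟨by simp, ?_⟩
  have hterm : ∀ j : ℕ, ∫⁻ x, {x | (j : ℝ) < |v x|}.indicator
      (fun _ => ENNReal.ofReal (Real.exp (j + 1))) x ∂m0 =
      ENNReal.ofReal (Real.exp (j + 1) * m0.real {x | (j : ℝ) < |v x|}) := by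
    intro j
    rw [lintegral_indicator_const₀ (nullMeasurableSet_lt_abs hv _),
      ENNReal.ofReal_mul (Real.exp_pos _).le, ofReal_measureReal]
  simp only [hterm]
  exact hsum.tsum_ofReal_lt_top

theorem memLp_top_of_measureReal_lt_abs_eq_zero (hv : AEStronglyMeasurable v m0) {d : ℝ}
    (h : m0.real {x | d < |v x|} = 0) : MemLp v ⊤ m0 := by
  refine memLp_top_of_bound hv d ?_
  rw [measureReal_eq_zero_iff] at h
  rw [ae_iff]
  simpa only [not_le, Real.norm_eq_abs] using h

end Distribution

theorem IsGrowthFunction.memLp_top_comp_abs_iff {α : Type*} {m : MeasurableSpace α}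
    {m0 : Measure α} {v : α → ℝ} {g : ℝ → ℝ} {μ : ℝ} (hg : IsGrowthFunction g μ)
    (hv : AEStronglyMeasurable v m0) :
    MemLp v ⊤ m0 ↔ MemLp (fun x => g |v x|) ⊤ m0 := by
  constructor
  · intro h
    have hfin : eLpNormEssSup v m0 ≠ ⊤ := by
      rw [← eLpNorm_exponent_top]; exact h.2.ne
    refine memLp_top_of_bound (hg.continuous_comp_abs.comp_aestronglyMeasurable hv)
      (g (eLpNormEssSup v m0).toReal) ?_
    filter_upwards [ae_le_eLpNormEssSup (f := v) (μ := m0)] with x hx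
    have h1 : |v x| ≤ (eLpNormEssSup v m0).toReal := by
      simpa using ENNReal.toReal_mono hfin hx
    rw [Real.norm_of_nonneg (hg.nonneg (abs_nonneg _))]
    exact hg.monotoneOn (abs_nonneg (v x)) ((abs_nonneg (v x)).trans h1) h1
  · intro h
    obtain ⟨c, hc, hcg⟩ := hg.exists_mul_le
    refine h.of_le_mul hv (c := c⁻¹) (ae_of_all _ fun x => ?_)
    rw [Real.norm_of_nonneg (hg.nonneg (abs_nonneg _)), Real.norm_eq_abs, ← div_eq_inv_mul,
      le_div_iff₀ hc, mul_comm]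
    exact hcg _ (abs_nonneg _)

/-! ### The main theorem. -/

theorem mainTheorem3 (n : ℕ) (hn : 2 ≤ n) (p μ ν M : ℝ) (hp : 1 < p) (hpn : p < n)
    (hμ : 1 ≤ μ) (hν : 0 < ν) :
    ∃ τ : ℝ, 0 < τ ∧
      ∀ (Ω : Set (EuclideanSpace ℝ (Fin n)))
        (g : ℝ → ℝ)
        (f : EuclideanSpace ℝ (Fin n) → EuclideanSpace ℝ (Fin n) → ℝ)
        (a ustar u : EuclideanSpace ℝ (Fin n) → ℝ)
        (σ : ℝ),
        IsOpen Ω → Bornology.IsBounded Ω →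
        IsGrowthFunction g μ →
        IsCaratheodory Ω f →
        (∀ x ∈ Ω, 0 ≤ a x) →
        (∀ᵐ x ∂(volume.restrict Ω), ∀ z, ν * g ‖z‖ ^ p - a x ≤ f x z) →
        MemW11 Ω ustar →
        1 < σ →
        MemLp a (ENNReal.ofReal σ) (volume.restrict Ω) →
        MemLp (fun x => f x (weakGradient Ω ustar x)) (ENNReal.ofReal σ) (volume.restrict Ω) →
        (eLpNorm (fun x => f x (weakGradient Ω ustar x) + a x) (ENNReal.ofReal σ)
          (volume.restrict Ω)).toReal = M →
        IsMinimizer Ω f ustar u →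
        (n / p < σ → MemLp (fun x => u x - ustar x) ⊤ (volume.restrict Ω)) ∧
        (σ = n / p → IntegrableOn (fun x => Real.exp (τ * |u x - ustar x|)) Ω) ∧
        (σ < n / p →
          MemMarcinkiewicz Ω (n * p * σ / (n - p * σ)) (fun x => g |u x - ustar x|) ∧
          n * p / (n - p) < n * p * σ / (n - p * σ)) ∧
        (MemLp (fun x => u x - ustar x) ⊤ (volume.restrict Ω) ↔
          MemLp (fun x => g |u x - ustar x|) ⊤ (volume.restrict Ω)) := by
  refine ⟨1, one_pos, ?_⟩
  intro Ω g f a ustar u σ hΩ hbdd hg _ _ hbd hstar hσ ha hf _ hu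
  obtain ⟨S, hS, hSob⟩ := HasW011Gradient.exists_level_set_inequality hn
  have hfin : volume Ω ≠ ⊤ := hbdd.measure_lt_top.ne
  have hfact := Fact.mk hfin.lt_top
  have hn1 : (1 : ℝ) < n := by exact_mod_cast hn
  have hn0 : (0 : ℝ) < n := by linarith
  have hp0 : 0 < p := by linarith
  have hσ0 : 0 < σ := by linarith
  have hσ1 : (1 : ℝ≥0∞) ≤ ENNReal.ofReal σ := by simpa using hσ.le
  have hv := HasW011Gradient.of_memW011 hu.1.1
  have hvm := hv.1.aestronglyMeasurable
  have hF : MemLp (fun x => f x (weakGradient Ω ustar x) + a x) (ENNReal.ofReal σ)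
    (volume.restrict Ω) := hf.add ha
  set α : ℝ := 1 - 1 / n with hα
  have hα0 : 0 < α := by rw [hα, sub_pos, div_lt_one hn0]; exact hn1
  have hα1 : α < 1 := by
    have : 0 < 1 / (n : ℝ) := by positivity
    linarith
  set Φ : ℝ → ℝ := fun k => (volume.restrict Ω).real {x | k < |u x - ustar x|}
  set N : ℝ → ℝ := fun k => (eLpNorm (fun x => f x (weakGradient Ω ustar x) + a x)
    (ENNReal.ofReal σ) ((volume.restrict Ω).restrict {x | k < |u x - ustar x|})).toReal
  have hΦ0 : ∀ k, 0 ≤ Φ k := fun k => measureReal_nonneg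
  have hΦ : Antitone Φ := fun k l hkl => measureReal_mono fun x hx => lt_of_le_of_lt hkl hx
  have hΦlim : Tendsto Φ atTop (𝓝 0) := by
    have h := (ENNReal.tendsto_toReal ENNReal.zero_ne_top).comp (tendsto_measure_lt_abs_atTop hvm)
    rwa [ENNReal.toReal_zero] at h
  have hN0 : ∀ k, 0 ≤ N k := fun k => ENNReal.toReal_nonneg
  have hNlim : Tendsto N atTop (𝓝 0) := tendsto_eLpNorm_restrict_lt_abs_atTop hvm hσ0 hF
  have hNle : ∀ k, N k ≤ (eLpNorm (fun x => f x (weakGradient Ω ustar x) + a x)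
      (ENNReal.ofReal σ) (volume.restrict Ω)).toReal + 1 := fun k =>
    (ENNReal.toReal_mono hF.2.ne (eLpNorm_mono_measure _ Measure.restrict_le_self)).trans
      (by linarith)
  -- The added `1` keeps `N₀` positive even when the norm is zero, so that `g s` can be prescribed
  -- in terms of it.
  set N₀ : ℝ := (eLpNorm (fun x => f x (weakGradient Ω ustar x) + a x)
    (ENNReal.ofReal σ) (volume.restrict Ω)).toReal + 1
  have hN₀ : 0 < N₀ := by positivity
  have key : ∀ k h s, 0 ≤ k → k < h → 0 < s →
      (h - k) * Φ h ^ α ≤ 2 * S * s * (Φ k + N k * Φ k ^ (1 - 1 / σ) / (ν * g s ^ p)) := by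
    intro k h s hk hkh hs
    have h1 := hu.setIntegral_norm_weakGradient_le hΩ hfin hstar (hf.integrable hσ1)
      (ha.integrable hσ1) hg hp.le hν hbd hk hs
    have h2 := setIntegral_le_eLpNorm_mul_measureReal_rpow hσ.le hF {x | k < |u x - ustar x|}
    have hgs := hg.pos s hs
    calc (h - k) * Φ h ^ α ≤ _ := hSob Ω _ _ hΩ.measurableSet hv hfin k h hk hkh
      _ ≤ _ := mul_le_mul_of_nonneg_left h1 hS.le
      _ ≤ S * (2 * s * (Φ k + N k * Φ k ^ (1 - 1 / σ) / (ν * g s ^ p))) := by gcongr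
      _ = _ := by ring
  obtain ⟨c, hc, hcg⟩ := hg.exists_mul_le
  refine ⟨fun hσn => ?_, fun hσn => ?_, fun hσn => ⟨⟨?_, ?_⟩, ?_⟩, hg.memLp_top_comp_abs_iff hvm⟩
  · rw [div_lt_iff₀ hp0] at hσn
    have hγ : α < 1 - 1 / (σ * p) := by
      have := one_div_lt_one_div_of_lt hn0 hσn
      linarith
    have hC : 0 < 2 * S * 1 * (1 + N₀ / (ν * (c * 1) ^ p)) := by positivity
    obtain ⟨d, -, hd⟩ := exists_eq_zero_of_superlinear_decay hΦ0 hΦ hα0 hγ hC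
      fun k h hk hkh => by
        have hx := Real.rpow_nonneg (hΦ0 k) (1 - 1 / (σ * p))
        have hNk := hNle k
        refine (mul_rpow_le_of_level_set_inequality hp0 hν hσ0 hα0 hS hΦ0 hΦ hN0 hc hcg key one_pos
          hk hkh).trans ?_
        gcongr
    exact memLp_top_of_measureReal_lt_abs_eq_zero hvm hd
  · simp only [one_mul]
    have hσp : σ * p = n := by rw [hσn, div_mul_cancel₀ _ hp0.ne']
    exact integrable_exp_abs_of_eventually_le hvm
      (eventually_le_mul_of_level_set_inequality hp0 hν hσ0 hα0 hS hΦ0 hΦ hN0 hNlim hc hcg key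
        (by rw [hσp]) (Real.exp_pos _))
  · exact (hg.continuous_comp_abs.comp_aestronglyMeasurable hvm).aemeasurable
  · rw [lt_div_iff₀ hp0] at hσn
    have hden : 0 < n - p * σ := by linarith
    have hm : 0 < n * p * σ / (n - p * σ) := by positivity
    have hσp : 0 ≤ 1 - 1 / (σ * p) := by
      rw [sub_nonneg, div_le_one (by positivity)]
      nlinarith
    obtain ⟨γ, hγ⟩ := exists_mul_rpow_le_of_level_set_inequality hg hp0 hν hσ0 hα0 hα1 hS hΦ0 hΦ
      hΦlim hN₀ (fun k _ => hNle k) key hm hσp (by rw [hα]; field_simp; ring)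
    refine ⟨γ, fun lam hlam => ?_⟩
    -- Every level is a value of `g`, and strict monotonicity identifies `{g(|v|) > g(k)}` with
    -- `{|v| > k}`.
    obtain ⟨k, hk, rfl⟩ := hg.exists_eq hlam
    have hset : {x ∈ Ω | g k < |(g |u x - ustar x|)|} = {x | k < |u x - ustar x|} ∩ Ω := by
      ext x
      rw [mem_inter_iff, and_comm]
      refine and_congr_right fun _ => ?_
      rw [abs_of_nonneg (hg.nonneg (abs_nonneg _))]
      exact hg.strictMonoOn.lt_iff_lt hk.le (abs_nonneg (u x - ustar x))
    rw [hset, ← Measure.restrict_apply' hΩ.measurableSet, ← ofReal_measureReal]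
    refine ENNReal.ofReal_le_ofReal ?_
    rw [le_div_iff₀ (Real.rpow_pos_of_pos hlam _)]
    exact hγ k hk
  · rw [lt_div_iff₀ hp0] at hσn
    have hden : 0 < n - p * σ := by linarith
    rw [div_lt_div_iff₀ (by linarith) hden]
    have hnp : 0 < n * p := by positivity
    have h1 : n - p * σ < σ * (n - p) := by nlinarith
    calc n * p * (n - p * σ) < n * p * (σ * (n - p)) := by gcongr
      _ = n * p * σ * (n - p) := by ring
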